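/- All graphs are finite directed acyclic graphs (DAGs), possibly with parallel edges; $t(e)$ and $h(e)$ denote the tail and head of an edge $e$. Let $G=(V,E)$ be a DAG with a netflow vector $\mathbf a\in\mathbb Z^V$, $\mathbf a\neq 0$, and let $$\mathcal F_G(\mathbf a)=\Big\{F\in\mathbb R_{\ge 0}^E:\ \sum_{t(e)=i}F(e)-\sum_{h(e)=i}F(e)=\mathbf a_i\ \text{ for all } i\in V\Big\}$$ be its flow polytope; its dimension is that of its affine span, with $\dim\emptyset=-1$. A *source* (*sink*) is a vertex without incoming (outgoing) edges, an *internal* vertex is one that is neither a source nor a sink, and a *route* is a path from a source to a sink. *Conservationist framed DAGs.* The vector $\mathbf a$ is *conservationist* if $\mathbf a_i=1$ at every source, $\mathbf a_i<0$ at every sink and $\mathbf a_i=0$ at every internal vertex. A *framing* of such a $(G,\mathbf a)$ consists of a total order on the outgoing edges of each non-sink vertex, a total order on the incoming edges of each internal vertex, and a total order on the set of sources. *Framed augmentations.* For arbitrary $(G,\mathbf a)$, an *augmentation* $(\hat G,\hat{\mathbf a})$ of $(G,\mathbf a)$ has vertex set $V\sqcup V_X\sqcup V_Y$ and edge set $E\sqcup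 E_X\sqcup E_Y$, where $E_X$ consists of edges from $V_X$ to vertices $i\in V$ with $\mathbf a_i>0$, exactly $\mathbf a_i$ of them ending at each such $i$; $E_Y$ consists of edges from vertices $i\in V$ with $\mathbf a_i<0$ to $V_Y$, at least $1$ and at most $|\mathbf a_i|$ of them beginning at each such $i$; and each vertex of $V_X$ (of $V_Y$) is incident to exactly one edge of $E_X$ (of $E_Y$). The netflow $\hat{\mathbf a}$ is $0$ on $V$, is $1$ on $V_X$, and is a negative integer at each vertex of $V_Y$, with $\mathbf a_i=\sum_{y\in E_Y,\,t(y)=i}\hat{\mathbf a}_{h(y)}$ for every $i\in V$ with $\mathbf a_i<0$. A *framing* of $(\hat G,\hat{\mathbf a})$ consists of total orders on the outgoing and on the incoming edges, in $\hat G$, of each vertex of $V$, and a total order on $V_X$. *Layering-simplices.* Let $(H,\mathbf b)$ with a framing be either of these two kinds of data. For two distinct paths $p,q$ from a vertex $i$ to sinks, $p<_i^+q$ means that, after their longest common initial part, $p$ continues with a smaller edge than $q$ in the outgoing order. For two distinct paths from sources to $i$, $p<_i^-q$ means that, before their longest common final part, $p$ arrives by a smaller edge than $q$ in the incoming order. Two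 routes are *incompatible* if they share a vertex $i$ at which, up to exchanging them, the part of $p$ before $i$ is $<_i^-$ that of $q$ and the part of $q$ after $i$ is $<_i^+$ that of $p$; otherwise they are *compatible*. A *route-clique* is a set of pairwise compatible routes. A *layering* is a set $L$ of routes of $H$ of which exactly $\mathbf b_i$ begin at each source $i$ and exactly $|\mathbf b_j|$ end at each sink $j$; so $L$ has exactly one route $L_s$ beginning at each source $s$ with $\mathbf b_s=1$, and no others. For distinct layerings, $L<M$ means $L_s<_s^+M_s$, where $s$ is the greatest such source, in the order of the framing, with $L_s\ne M_s$; this is a total order. For a set $\mathcal S$ of layerings let $\mathrm{routes}(\mathcal S)=\bigcup_{L\in\mathcal S}L$. A (possibly empty) set $\mathcal L=\{L^1<\dots<L^m\}$ of layerings is a *layering-simplex* if 1. $\mathrm{routes}(\mathcal L)$ is a route-clique; 2. for every $i$, $L^i$ is the least layering $L$ with $L\subseteq\mathrm{routes}(\{L^i,\dots,L^m\})$; 3. for every $i$, some route of $L^i$ is not in $\mathrm{routes}(\{L^{i+1},\dots,L^m\})$. **Statement.** Let $G$ be a DAG with netflow vector $\mathbf a\ne 0$. (a) For every framed augmentation of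 $(G,\mathbf a)$, every inclusion-maximal layering-simplex has cardinality $\dim\mathcal F_G(\mathbf a)+1$. (b) If $\mathbf a$ is conservationist, then for every framing of $(G,\mathbf a)$, every inclusion-maximal layering-simplex has cardinality $\dim\mathcal F_G(\mathbf a)+1$. -/

import Mathlib

namespace FramedFlow

/-- A directed graph with vertex set `V` and edge set `E`; parallel edges are allowed. -/
structure DirGraph (V E : Type*) where
  /-- The vertex at which an edge begins. -/
  tail : E → V
  /-- The vertex at which an edge ends. -/
  head : E → V

namespace DirGraph

variable {V E : Type*}

/-- The list of consecutive edges `es` is a directed path from `u` to `v`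
(the empty list is the trivial path at a vertex). -/
def IsPath (G : DirGraph V E) : V → List E → V → Prop
  | u, [], v => u = v
  | u, e :: es, v => G.tail e = u ∧ IsPath G (G.head e) es v

/-- There are no oriented cycles: every closed directed path is trivial. -/
def Acyclic (G : DirGraph V E) : Prop :=
  ∀ (v : V) (es : List E), G.IsPath v es v → es = []

/-- A source is a vertex with no incoming edges. -/
def IsSource (G : DirGraph V E) (i : V) : Prop := ∀ e, G.head e ≠ i

/-- A sink is a vertex with no outgoing edges. -/
def IsSink (G : DirGraph V E) (i : V) : Prop := ∀ e, G.tail e ≠ i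

/-- An internal vertex is one that is neither a source nor a sink. -/
def IsInternal (G : DirGraph V E) (i : V) : Prop := ¬ G.IsSource i ∧ ¬ G.IsSink i

/-- The edges that leave the vertex `i`. -/
def outEdges (G : DirGraph V E) (i : V) : Set E := {e | G.tail e = i}

/-- The edges that enter the vertex `i`. -/
def inEdges (G : DirGraph V E) (i : V) : Set E := {e | G.head e = i}

/-- A route: a directed path from a source to a sink. -/
@[ext]
structure Route (G : DirGraph V E) where
  /-- The first vertex. -/
  start : V
  /-- The last vertex. -/
  finish : V
  /-- The edges, in the order in which they are traversed. -/
  edges : List E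
  isPath : G.IsPath start edges finish
  start_isSource : G.IsSource start
  finish_isSink : G.IsSink finish

open scoped Classical in
/-- The flow polytope of `(G, a)`: all nonnegative functions `F` on the edges whose net outflow
at every vertex `i` is `a i`. -/
def flowPolytope [Fintype E] (G : DirGraph V E) (a : V → ℤ) : Set (E → ℝ) :=
  {F | (∀ e, 0 ≤ F e) ∧
    ∀ i, ∑ e with G.tail e = i, F e - ∑ e with G.head e = i, F e = (a i : ℝ)}

/-- Every source has netflow `1`, every sink has negative netflow and every internal vertex has
netflow `0`. -/
structure IsConservationist (G : DirGraph V E) (a : V → ℤ) : Prop where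
  source : ∀ i, G.IsSource i → a i = 1
  sink : ∀ i, G.IsSink i → a i < 0
  internal : ∀ i, G.IsInternal i → a i = 0

end DirGraph

open scoped Classical in
/-- The dimension of a polytope: that of its affine span, and `-1` for the empty polytope. -/
noncomputable def polytopeDim {E : Type*} (P : Set (E → ℝ)) : ℤ :=
  if P = ∅ then -1 else (Module.finrank ℝ (vectorSpan ℝ P) : ℤ)

/-- The relation `r` restricts to a (strict) total order on the set `s`. -/
structure TotalOrderOn {α : Type*} (r : α → α → Prop) (s : Set α) : Prop where
  irrefl : ∀ x ∈ s, ¬ r x x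
  trans : ∀ x ∈ s, ∀ y ∈ s, ∀ z ∈ s, r x y → r y z → r x z
  total : ∀ x ∈ s, ∀ y ∈ s, x ≠ y → r x y ∨ r y x

/-- The raw data of a framing. Only the comparisons of two edges that leave the same vertex, of
two edges that enter the same vertex, and of two starting vertices of routes are used; which of
them have to be total orders is said in `IsConsFraming` and `Augmentation.IsFraming`. -/
structure FramingData (V E : Type*) where
  /-- The order on the edges that leave a vertex. -/
  outLt : E → E → Prop
  /-- The order on the edges that enter a vertex. -/
  inLt : E → E → Prop
  /-- The order on the sources. -/
  srcLt : V → V → Prop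

/-- A framing of a directed graph with conservationist netflow vector: total orders on the outgoing
edges of each vertex that is not a sink, on the incoming edges of each internal vertex,
and on the set of sources. -/
structure IsConsFraming {V E : Type*} (G : DirGraph V E) (F : FramingData V E) : Prop where
  out : ∀ i, ¬ G.IsSink i → TotalOrderOn F.outLt (G.outEdges i)
  inc : ∀ i, G.IsInternal i → TotalOrderOn F.inLt (G.inEdges i)
  src : TotalOrderOn F.srcLt {i | G.IsSource i}

section Layerings

variable {V E : Type*} {G : DirGraph V E}

/-- The comparison of two paths with the same first vertex: at the end of their longest common
initial part, `p` continues with an edge `f`, `q` continues with an edge `g`, and `f` is smaller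
than `g` in the order on outgoing edges. -/
def FramingData.PostLt (F : FramingData V E) (p q : List E) : Prop :=
  ∃ (σ p₁ q₁ : List E) (f g : E),
    p = σ ++ f :: p₁ ∧ q = σ ++ g :: q₁ ∧ f ≠ g ∧ F.outLt f g

/-- The comparison of two paths with the same last vertex: their longest common final part is
preceded by an edge `f` in `p` and by an edge `g` in `q`, and `f` is smaller than `g` in the
order on incoming edges. -/
def FramingData.PreLt (F : FramingData V E) (p q : List E) : Prop :=
  ∃ (σ p₁ q₁ : List E) (f g : E),
    p = p₁ ++ f :: σ ∧ q = q₁ ++ g :: σ ∧ f ≠ g ∧ F.inLt f g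

/-- Both routes pass through the vertex `i`; up to `i` the route `p` is smaller than `q`, and
from `i` on the route `q` is smaller than `p`. -/
def FramingData.CrossAt (F : FramingData V E) (i : V) (p q : G.Route) : Prop :=
  ∃ p₁ p₂ q₁ q₂ : List E,
    p.edges = p₁ ++ p₂ ∧ G.IsPath p.start p₁ i ∧ G.IsPath i p₂ p.finish ∧
    q.edges = q₁ ++ q₂ ∧ G.IsPath q.start q₁ i ∧ G.IsPath i q₂ q.finish ∧
    F.PreLt p₁ q₁ ∧ F.PostLt q₂ p₂

/-- Two routes are compatible if they are not incompatible at any shared vertex. -/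
def FramingData.Compatible (F : FramingData V E) (p q : G.Route) : Prop :=
  ∀ i, ¬ F.CrossAt i p q ∧ ¬ F.CrossAt i q p

/-- A route-clique is a set of pairwise compatible routes. -/
def FramingData.IsRouteClique (F : FramingData V E) (R : Set G.Route) : Prop :=
  ∀ p ∈ R, ∀ q ∈ R, F.Compatible p q

open scoped Classical in
/-- A layering: a set of routes of which exactly `a i` begin at each source `i` and exactly `|a j|`
end at each sink `j`. -/
structure IsLayering (G : DirGraph V E) (a : V → ℤ) (L : Finset G.Route) : Prop where
  source : ∀ i, G.IsSource i → ((L.filter fun p => p.start = i).card : ℤ) = a i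
  sink : ∀ j, G.IsSink j → ((L.filter fun p => p.finish = j).card : ℤ) = |a j|

/-- The post-source order on layerings: `L` is smaller than `M` if, at the greatest
source at which they have different routes, the route of `L` is smaller than that of `M`. -/
def FramingData.LayeringLt (F : FramingData V E) (L M : Finset G.Route) : Prop :=
  ∃ p ∈ L, ∃ q ∈ M, p.start = q.start ∧ F.PostLt p.edges q.edges ∧
    ∀ p₁ ∈ L, ∀ q₁ ∈ M, p₁.start = q₁.start → F.srcLt p.start p₁.start → p₁ = q₁

/-- The set of all routes that occur in a layering of the family `S`. -/
def routes (S : Set (Finset G.Route)) : Set G.Route := {p | ∃ L ∈ S, p ∈ L}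

/-- Layering-simplices. If the members are written in increasing order as `L¹ < ⋯ < Lᵐ` and
`L = Lⁱ`, then `{K ∈ 𝓛 | K = L ∨ L < K}` is `{Lⁱ, …, Lᵐ}`, and
`{K ∈ 𝓛 | L < K}` is `{Lⁱ⁺¹, …, Lᵐ}`. -/
structure IsLayeringSimplex (G : DirGraph V E) (a : V → ℤ) (F : FramingData V E)
    (𝓛 : Finset (Finset G.Route)) : Prop where
  layering : ∀ L ∈ 𝓛, IsLayering G a L
  clique : F.IsRouteClique (routes (G := G) {L | L ∈ 𝓛})
  least : ∀ L ∈ 𝓛, ∀ M : Finset G.Route, IsLayering G a M →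
    (∀ p ∈ M, p ∈ routes {K | K ∈ 𝓛 ∧ (K = L ∨ F.LayeringLt L K)}) →
    L = M ∨ F.LayeringLt L M
  newRoute : ∀ L ∈ 𝓛, ∃ p ∈ L, p ∉ routes {K | K ∈ 𝓛 ∧ F.LayeringLt L K}

end Layerings

open scoped Classical in
/-- An augmentation of `(G, a)`, with new vertices `X` and `Y` (the inflow and the
outflow vertices) and new edges `EX` (from `X` to `V`) and `EY` (from `V` to `Y`). -/
structure Augmentation {V E : Type*} (G : DirGraph V E) (a : V → ℤ) (X Y EX EY : Type*)
    [Fintype EX] [Fintype EY] where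
  /-- The beginning of an inflow edge. -/
  xTail : EX → X
  /-- The end of an inflow edge. -/
  xHead : EX → V
  /-- The beginning of an outflow edge. -/
  yTail : EY → V
  /-- The end of an outflow edge. -/
  yHead : EY → Y
  /-- The new netflow at the outflow vertices. -/
  yNetflow : Y → ℤ
  /-- Every inflow vertex is on exactly one inflow edge. -/
  xTail_bijective : Function.Bijective xTail
  xHead_pos : ∀ x, 0 < a (xHead x)
  card_inflow : ∀ i, 0 < a i → (Nat.card {x : EX // xHead x = i} : ℤ) = a i
  /-- Every outflow vertex is on exactly one outflow edge. -/
  yHead_bijective : Function.Bijective yHead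
  yTail_neg : ∀ y, a (yTail y) < 0
  one_le_card_outflow : ∀ i, a i < 0 → (1 : ℤ) ≤ Nat.card {y : EY // yTail y = i}
  card_outflow_le : ∀ i, a i < 0 → (Nat.card {y : EY // yTail y = i} : ℤ) ≤ |a i|
  yNetflow_neg : ∀ y, yNetflow y < 0
  sum_yNetflow : ∀ i, a i < 0 → a i = ∑ y with yTail y = i, yNetflow (yHead y)

namespace Augmentation

variable {V E X Y EX EY : Type*} [Fintype EX] [Fintype EY] {G : DirGraph V E} {a : V → ℤ}

/-- The augmented graph. -/
def graph (A : Augmentation G a X Y EX EY) : DirGraph (V ⊕ X ⊕ Y) (E ⊕ EX ⊕ EY) where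
  tail
    | .inl e => .inl (G.tail e)
    | .inr (.inl x) => .inr (.inl (A.xTail x))
    | .inr (.inr y) => .inl (A.yTail y)
  head
    | .inl e => .inl (G.head e)
    | .inr (.inl x) => .inl (A.xHead x)
    | .inr (.inr y) => .inr (.inr (A.yHead y))

/-- The netflow vector of the augmented graph. -/
def netflow (A : Augmentation G a X Y EX EY) : V ⊕ X ⊕ Y → ℤ
  | .inl _ => 0
  | .inr (.inl _) => 1
  | .inr (.inr y) => A.yNetflow y

/-- A framing of an augmentation: total orders on the outgoing and on the incoming edges, in the
augmented graph, of each old vertex, and a total order on the set of inflow vertices. -/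
structure IsFraming (A : Augmentation G a X Y EX EY)
    (F : FramingData (V ⊕ X ⊕ Y) (E ⊕ EX ⊕ EY)) : Prop where
  out : ∀ i : V, TotalOrderOn F.outLt (A.graph.outEdges (.inl i))
  inc : ∀ i : V, TotalOrderOn F.inLt (A.graph.inEdges (.inl i))
  src : TotalOrderOn F.srcLt (Set.range fun x : X => Sum.inr (Sum.inl x))

end Augmentation

end FramedFlow

/-! ### Finite strict total orders and numerical ranks. -/

namespace FramedFlow

open scoped Classical

/-! Both parts follow from one statement about a framed graph whose netflow is 0 or 1 at sources,
nonpositive at sinks and zero elsewhere (`IsUnitSupply`, `IsFramed`). Its core is that every point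
of the flow polytope is a convex combination, with positive coefficients, of the flows of a
layering-simplex, and that the point determines both the simplex and the coefficients
(`exists_convexCombination`, `IsLayeringSimplex.convexCombination_unique`). This is shown in two
stages.

From flows to routes: a flow `f` has exactly one decomposition into nonnegative route weights
supported on a route-clique. For a path `q` from `v` to a sink, let `w v q` be the weight of the
routes that pass through `v` and continue along `q`. At a vertex `v` that is not a source, the
matrix of the `w (G.tail g) (g :: q)`, with `g` an edge into `v`, has row sums `w v q` and column
sums `f g`. Compatibility of routes means that the supports of these matrices are chains for the two
orders of the framing. A nonnegative matrix with chain support exists for all margins of equal total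
and is determined by them (`exists_isChainCoupling`, `IsChainCoupling.unique`), so `w` is computed
from the sinks backwards.

From routes to layerings: route weights with the right margins contain a layering in their support,
by Hall's theorem. Take the least such layering, subtract the largest possible multiple of it, and
repeat (`exists_layerSum_eq`). The members found form a layering-simplex. Conversely, conditions 2
and 3 say that the least member of a simplex is the least layering in the support and that its
coefficient is the least weight on its routes, so this procedure recovers the simplex
(`layerSum_unique`).

For the dimension, uniqueness makes the flows of a layering-simplex affinely independent. If the
simplex is maximal and nonempty, its barycentre lies in the hull of no other layering-simplex. There
are finitely many hulls and they are closed, so a short segment from the barycentre towards any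
point of the polytope stays in the hull of the given simplex. Hence simplex and polytope have the
same directions. For an augmentation, the flow on the new edges is forced, so the polytope is a
translate of an embedded copy of the original one. -/

theorem TotalOrderOn.exists_rank {α : Type*} {r : α → α → Prop} {s : Set α} (hs : s.Finite)
    (h : TotalOrderOn r s) :
    ∃ f : α → ℕ, Set.InjOn f s ∧ ∀ x ∈ s, ∀ y ∈ s, r x y ↔ f x < f y := by
  have mono : ∀ x ∈ s, ∀ y ∈ s, r x y →
      (hs.toFinset.filter (r · x)).card < (hs.toFinset.filter (r · y)).card := by
    intro x hx y hy hxy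
    apply Finset.card_lt_card
    rw [Finset.ssubset_iff_of_subset]
    · exact ⟨x, by simp [hx, hxy], by simp [h.irrefl x hx]⟩
    · intro z hz
      simp only [Finset.mem_filter, Set.Finite.mem_toFinset] at hz ⊢
      exact ⟨hz.1, h.trans z hz.1 x hx y hy hz.2 hxy⟩
  refine ⟨fun x => (hs.toFinset.filter (r · x)).card, ?_, fun x hx y hy => ⟨mono x hx y hy, ?_⟩⟩
  · intro x hx y hy hxy
    by_contra hne
    rcases h.total x hx y hy hne with h' | h'
    · exact (mono x hx y hy h').ne hxy
    · exact (mono y hy x hx h').ne' hxy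
  · intro hlt
    have hne : x ≠ y := by rintro rfl; exact lt_irrefl _ hlt
    rcases h.total x hx y hy hne with h' | h'
    · exact h'
    · exact absurd (mono y hy x hx h') (not_lt.2 hlt.le)

theorem TotalOrderOn.exists_least {α : Type*} {r : α → α → Prop} {s t : Set α} (hs : s.Finite)
    (h : TotalOrderOn r s) (hts : t ⊆ s) (ht : t.Nonempty) :
    ∃ x ∈ t, ∀ y ∈ t, x = y ∨ r x y := by
  obtain ⟨f, hf, hr⟩ := h.exists_rank hs
  obtain ⟨x, hx, hmin⟩ := Set.exists_min_image t f (hs.subset hts) ht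
  refine ⟨x, hx, fun y hy => ?_⟩
  rcases (hmin y hy).lt_or_eq with h' | h'
  · exact Or.inr ((hr x (hts hx) y (hts hy)).2 h')
  · exact Or.inl (hf (hts hx) (hts hy) h')

theorem TotalOrderOn.asymm {α : Type*} {r : α → α → Prop} {s : Set α}
    (h : TotalOrderOn r s) {x y : α} (hx : x ∈ s) (hy : y ∈ s) (hxy : r x y) : ¬ r y x :=
  fun hyx => h.irrefl x hx (h.trans x hx y hy x hx hxy hyx)

theorem TotalOrderOn.ne_and {α : Type*} {r : α → α → Prop} {s : Set α}
    (h : TotalOrderOn r s) : TotalOrderOn (fun x y => x ≠ y ∧ r x y) s where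
  irrefl := fun x _ hx => hx.1 rfl
  trans := by
    rintro x hx y hy z hz ⟨_, hxy⟩ ⟨_, hyz⟩
    refine ⟨?_, h.trans x hx y hy z hz hxy hyz⟩
    rintro rfl
    exact h.asymm hx hy hxy hyz
  total := fun x hx y hy hne =>
    (h.total x hx y hy hne).imp (fun h' => ⟨hne, h'⟩) (fun h' => ⟨hne.symm, h'⟩)

/-- For vertices with at most one relevant edge, where a framing need not prescribe an order. -/
theorem TotalOrderOn.of_subsingleton {α : Type*} {r : α → α → Prop} {s : Set α}
    (hs : s.Subsingleton) : TotalOrderOn (fun x y => x ≠ y ∧ r x y) s where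
  irrefl := fun _ _ hx => hx.1 rfl
  trans := fun _ hx _ hy _ _ hxy _ => absurd (hs hx hy) hxy.1
  total := fun _ hx _ hy hne => absurd (hs hx hy) hne

theorem TotalOrderOn.mono {α : Type*} {r : α → α → Prop} {s t : Set α}
    (h : TotalOrderOn r s) (hts : t ⊆ s) : TotalOrderOn r t where
  irrefl := fun x hx => h.irrefl x (hts hx)
  trans := fun x hx y hy z hz => h.trans x (hts hx) y (hts hy) z (hts hz)
  total := fun x hx y hy => h.total x (hts hx) y (hts hy)

/-! ### Matrices with given margins and chain support. -/

/-- A nonnegative matrix with prescribed row and column sums whose support is a chain. -/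
structure IsChainCoupling {α β : Type*} (f : α → ℕ) (g : β → ℕ) (A : Finset α) (B : Finset β)
    (r : α → ℝ) (c : β → ℝ) (M : α → β → ℝ) : Prop where
  nonneg : ∀ a ∈ A, ∀ b ∈ B, 0 ≤ M a b
  row : ∀ a ∈ A, ∑ b ∈ B, M a b = r a
  col : ∀ b ∈ B, ∑ a ∈ A, M a b = c b
  chain : ∀ a ∈ A, ∀ a' ∈ A, ∀ b ∈ B, ∀ b' ∈ B, f a < f a' → g b' < g b →
    M a b = 0 ∨ M a' b' = 0

theorem IsChainCoupling.transpose {α β : Type*} {f : α → ℕ} {g : β → ℕ} {A : Finset α}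
    {B : Finset β} {r : α → ℝ} {c : β → ℝ} {M : α → β → ℝ} (h : IsChainCoupling f g A B r c M) :
    IsChainCoupling g f B A c r (fun b a => M a b) where
  nonneg := fun b hb a ha => h.nonneg a ha b hb
  row := h.col
  col := h.row
  chain := fun b hb b' hb' a ha a' ha' hbb haa => (h.chain a' ha' a ha b' hb' b hb haa hbb).symm

/-- One step of the northwest corner rule: the whole of row `a₀` is put into column `b₀`. Both are
minimal, so the new entry is never part of an antitone pair. -/
theorem IsChainCoupling.extend_row {α β : Type*} {f : α → ℕ} {g : β → ℕ} {A : Finset α}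
    {B : Finset β} {r : α → ℝ} {c : β → ℝ} {M : α → β → ℝ} {a₀ : α} {b₀ : β} (ha₀ : a₀ ∈ A)
    (hb₀ : b₀ ∈ B) (hf : ∀ a ∈ A, f a₀ ≤ f a) (hg : ∀ b ∈ B, g b₀ ≤ g b) (hr : 0 ≤ r a₀)
    (h : IsChainCoupling f g (A.erase a₀) B r (Function.update c b₀ (c b₀ - r a₀)) M) :
    IsChainCoupling f g A B r c
      (fun a b => if a = a₀ then (if b = b₀ then r a₀ else 0) else M a b) where
  nonneg := by
    intro a ha b hb
    split_ifs with h1 h2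
    · exact hr
    · exact le_rfl
    · exact h.nonneg a (Finset.mem_erase.2 ⟨h1, ha⟩) b hb
  row := by
    intro a ha
    by_cases h1 : a = a₀
    · simp [h1, hb₀]
    · simpa [h1] using h.row a (Finset.mem_erase.2 ⟨h1, ha⟩)
  col := by
    intro b hb
    rw [← Finset.add_sum_erase A _ ha₀]
    have : ∑ a ∈ A.erase a₀, (if a = a₀ then (if b = b₀ then r a₀ else 0) else M a b)
        = ∑ a ∈ A.erase a₀, M a b :=
      Finset.sum_congr rfl fun a ha => by simp [Finset.ne_of_mem_erase ha]
    rw [this, h.col b hb]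
    by_cases hbb : b = b₀
    · subst hbb; simp
    · simp [hbb]
  chain := by
    intro a ha a' ha' b hb b' hb' h1 h2
    have ha'0 : a' ≠ a₀ := by
      rintro rfl; exact absurd (hf a ha) (not_le.2 h1)
    by_cases h3 : a = a₀
    · have : b ≠ b₀ := by
        rintro rfl; exact absurd (hg b' hb') (not_le.2 h2)
      simp [h3, this]
    · simpa [h3, ha'0] using h.chain a (Finset.mem_erase.2 ⟨h3, ha⟩) a'
        (Finset.mem_erase.2 ⟨ha'0, ha'⟩) b hb b' hb' h1 h2

theorem sum_update_sub {β : Type*} {B : Finset β} {c : β → ℝ} {b₀ : β} (hb₀ : b₀ ∈ B) (x : ℝ) :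
    ∑ b ∈ B, Function.update c b₀ (c b₀ - x) b = ∑ b ∈ B, c b - x := by
  rw [Finset.sum_update_of_mem hb₀, ← Finset.add_sum_erase B c hb₀, Finset.sdiff_singleton_eq_erase]
  ring

theorem update_sub_nonneg {β : Type*} {B : Finset β} {c : β → ℝ} {b₀ : β} {x : ℝ}
    (hc : ∀ b ∈ B, 0 ≤ c b) (hx : x ≤ c b₀) :
    ∀ b ∈ B, 0 ≤ Function.update c b₀ (c b₀ - x) b := by
  intro b hb
  by_cases h : b = b₀
  · subst h; simpa using hx
  · simpa [h] using hc b hb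

/-- The northwest corner rule: the least row and the least column share the smaller of their two
margins, and the exhausted one is removed. -/
theorem exists_isChainCoupling {α β : Type*} (f : α → ℕ) (g : β → ℕ) (n : ℕ) :
    ∀ (A : Finset α) (B : Finset β), A.card + B.card = n → ∀ (r : α → ℝ) (c : β → ℝ),
      (∀ a ∈ A, 0 ≤ r a) → (∀ b ∈ B, 0 ≤ c b) → ∑ a ∈ A, r a = ∑ b ∈ B, c b →
      ∃ M, IsChainCoupling f g A B r c M := by
  induction n with
  | zero =>
    intro A B hn r c _ _ _
    have hA : A = ∅ := Finset.card_eq_zero.1 (by omega)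
    have hB : B = ∅ := Finset.card_eq_zero.1 (by omega)
    subst hA hB
    exact ⟨0, by constructor <;> simp⟩
  | succ n ih =>
    intro A B hn r c hr hc hs
    rcases A.eq_empty_or_nonempty with rfl | hA
    · rw [Finset.sum_empty, eq_comm, Finset.sum_eq_zero_iff_of_nonneg hc] at hs
      exact ⟨0, ⟨by simp, by simp, fun b hb => by simp [hs b hb], by simp⟩⟩
    rcases B.eq_empty_or_nonempty with rfl | hB
    · rw [Finset.sum_empty, Finset.sum_eq_zero_iff_of_nonneg hr] at hs
      exact ⟨0, ⟨by simp, fun a ha => by simp [hs a ha], by simp, by simp⟩⟩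
    obtain ⟨a₀, ha₀, hf⟩ := Finset.exists_min_image A f hA
    obtain ⟨b₀, hb₀, hg⟩ := Finset.exists_min_image B g hB
    rcases le_total (r a₀) (c b₀) with hle | hle
    · obtain ⟨M, hM⟩ := ih (A.erase a₀) B
        (by rw [Finset.card_erase_of_mem ha₀]; have := Finset.card_pos.2 hA; omega) r
        (Function.update c b₀ (c b₀ - r a₀)) (fun a ha => hr a (Finset.mem_of_mem_erase ha))
        (update_sub_nonneg hc hle) (by
          rw [sum_update_sub hb₀, ← hs, ← Finset.add_sum_erase A r ha₀]; ring)
      exact ⟨_, hM.extend_row ha₀ hb₀ hf hg (hr a₀ ha₀)⟩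
    · obtain ⟨M, hM⟩ := ih A (B.erase b₀)
        (by rw [Finset.card_erase_of_mem hb₀]; have := Finset.card_pos.2 hB; omega)
        (Function.update r a₀ (r a₀ - c b₀)) c (update_sub_nonneg hr hle)
        (fun b hb => hc b (Finset.mem_of_mem_erase hb)) (by
          rw [sum_update_sub ha₀, hs, ← Finset.add_sum_erase B c hb₀]; ring)
      exact ⟨_, (hM.transpose.extend_row hb₀ ha₀ hg hf (hc b₀ hb₀)).transpose⟩

/-- The two blocks next to the corner block on the antidiagonal cannot both contain a nonzero entry.
If one of them vanishes, the corner block carries its full row total or its full column total. -/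
theorem IsChainCoupling.sum_filter_eq_min {α β : Type*} {f : α → ℕ} {g : β → ℕ} {A : Finset α}
    {B : Finset β} {r : α → ℝ} {c : β → ℝ} {M : α → β → ℝ} (h : IsChainCoupling f g A B r c M)
    (m k : ℕ) :
    ∑ a ∈ A with f a < m, ∑ b ∈ B with g b < k, M a b =
      min (∑ a ∈ A with f a < m, r a) (∑ b ∈ B with g b < k, c b) := by
  have hr : ∑ a ∈ A with f a < m, r a = ∑ a ∈ A with f a < m, ∑ b ∈ B with g b < k, M a b +
      ∑ a ∈ A with f a < m, ∑ b ∈ B with ¬ g b < k, M a b := by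
    rw [← Finset.sum_add_distrib]
    refine Finset.sum_congr rfl fun a ha => ?_
    rw [Finset.sum_filter_add_sum_filter_not, h.row a (Finset.mem_filter.1 ha).1]
  have hc : ∑ b ∈ B with g b < k, c b = ∑ a ∈ A with f a < m, ∑ b ∈ B with g b < k, M a b +
      ∑ a ∈ A with ¬ f a < m, ∑ b ∈ B with g b < k, M a b := by
    rw [Finset.sum_filter_add_sum_filter_not, Finset.sum_comm]
    exact Finset.sum_congr rfl fun b hb => (h.col b (Finset.mem_filter.1 hb).1).symm
  have h1 : 0 ≤ ∑ a ∈ A with f a < m, ∑ b ∈ B with ¬ g b < k, M a b :=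
    Finset.sum_nonneg fun a ha => Finset.sum_nonneg fun b hb =>
      h.nonneg a (Finset.mem_filter.1 ha).1 b (Finset.mem_filter.1 hb).1
  have h2 : 0 ≤ ∑ a ∈ A with ¬ f a < m, ∑ b ∈ B with g b < k, M a b :=
    Finset.sum_nonneg fun a ha => Finset.sum_nonneg fun b hb =>
      h.nonneg a (Finset.mem_filter.1 ha).1 b (Finset.mem_filter.1 hb).1
  by_cases hz : ∃ a ∈ A, ∃ b ∈ B, f a < m ∧ ¬ g b < k ∧ M a b ≠ 0
  · obtain ⟨a, ha, b, hb, ham, hbk, hne⟩ := hz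
    have : ∑ a ∈ A with ¬ f a < m, ∑ b ∈ B with g b < k, M a b = 0 := by
      refine Finset.sum_eq_zero fun a' ha' => Finset.sum_eq_zero fun b' hb' => ?_
      rw [Finset.mem_filter] at ha' hb'
      exact (h.chain a ha a' ha'.1 b hb b' hb'.1 (by omega) (by omega)).resolve_left hne
    rw [min_eq_right] <;> linarith
  · push Not at hz
    have : ∑ a ∈ A with f a < m, ∑ b ∈ B with ¬ g b < k, M a b = 0 := by
      refine Finset.sum_eq_zero fun a ha => Finset.sum_eq_zero fun b hb => ?_
      rw [Finset.mem_filter] at ha hb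
      exact hz a ha.1 b hb.1 ha.2 (not_lt.1 hb.2)
    rw [min_eq_left] <;> linarith

theorem sum_filter_lt_succ {α : Type*} {f : α → ℕ} {A : Finset α} (hf : Set.InjOn f A) {a : α}
    (ha : a ∈ A) (r : α → ℝ) :
    ∑ x ∈ A with f x < f a + 1, r x = r a + ∑ x ∈ A with f x < f a, r x := by
  have : A.filter (fun x => f x < f a + 1) = insert a (A.filter fun x => f x < f a) := by
    ext x
    simp only [Finset.mem_filter, Finset.mem_insert, Nat.lt_succ_iff_lt_or_eq]
    constructor
    · rintro ⟨hx, h | h⟩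
      · exact Or.inr ⟨hx, h⟩
      · exact Or.inl (hf hx ha h)
    · rintro (rfl | ⟨hx, h⟩)
      · exact ⟨ha, Or.inr rfl⟩
      · exact ⟨hx, Or.inl h⟩
  rw [this, Finset.sum_insert (by simp)]

/-- Corner sums depend only on the margins; since the ranks are injective, differences of corner
sums isolate single entries. -/
theorem IsChainCoupling.unique {α β : Type*} {f : α → ℕ} {g : β → ℕ} {A : Finset α}
    {B : Finset β} {r r' : α → ℝ} {c : β → ℝ} {M M' : α → β → ℝ} (hf : Set.InjOn f A)
    (hg : Set.InjOn g B) (h : IsChainCoupling f g A B r c M)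
    (h' : IsChainCoupling f g A B r' c M') (hr : ∀ a ∈ A, r a = r' a) :
    ∀ a ∈ A, ∀ b ∈ B, M a b = M' a b := by
  intro a ha b hb
  have key : ∀ m k, ∑ a ∈ A with f a < m, ∑ b ∈ B with g b < k, M a b =
      ∑ a ∈ A with f a < m, ∑ b ∈ B with g b < k, M' a b := by
    intro m k
    rw [h.sum_filter_eq_min, h'.sum_filter_eq_min]
    congr 1
    exact Finset.sum_congr rfl fun a ha => hr a (Finset.mem_filter.1 ha).1
  have k1 : ∀ k, ∑ b ∈ B with g b < k, M a b = ∑ b ∈ B with g b < k, M' a b := by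
    intro k
    have e1 := key (f a + 1) k
    have e2 := key (f a) k
    rw [sum_filter_lt_succ hf ha, sum_filter_lt_succ hf ha] at e1
    linarith
  have e1 := k1 (g b + 1)
  have e2 := k1 (g b)
  rw [sum_filter_lt_succ hg hb, sum_filter_lt_succ hg hb] at e1
  linarith

/-! ### Paths and routes in acyclic graphs. -/

namespace DirGraph

variable {V E : Type*} {G : DirGraph V E}

theorem isPath_append {u v : V} {p q : List E} :
    G.IsPath u (p ++ q) v ↔ ∃ m, G.IsPath u p m ∧ G.IsPath m q v := by
  induction p generalizing u with
  | nil => simp [IsPath]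
  | cons e p ih => simp [IsPath, ih, and_assoc]

theorem IsPath.append {u m v : V} {p q : List E} (hp : G.IsPath u p m) (hq : G.IsPath m q v) :
    G.IsPath u (p ++ q) v :=
  isPath_append.2 ⟨m, hp, hq⟩

theorem IsPath.end_unique {u v v' : V} {p : List E} (h : G.IsPath u p v) (h' : G.IsPath u p v') :
    v = v' := by
  induction p generalizing u with
  | nil => exact Eq.trans (Eq.symm h) h'
  | cons e p ih => exact ih h.2 h'.2

theorem IsPath.nodup (hG : G.Acyclic) {u v : V} {p : List E} (h : G.IsPath u p v) : p.Nodup := by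
  induction p generalizing u with
  | nil => exact List.nodup_nil
  | cons e p ih =>
    refine List.nodup_cons.2 ⟨fun he => ?_, ih h.2⟩
    obtain ⟨l, r, rfl⟩ := List.append_of_mem he
    obtain ⟨m, hm, hm'⟩ := isPath_append.1 h.2
    have : G.IsPath m (e :: l) m := ⟨hm'.1, hm'.1 ▸ hm⟩
    exact absurd (hG m _ this) (by simp)

theorem IsPath.eq_nil_of_isSink {u v : V} {p : List E} (h : G.IsPath u p v) (hu : G.IsSink u) :
    p = [] := by
  cases p with
  | nil => rfl
  | cons e p => exact absurd h.1 (hu e)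

theorem IsPath.eq_nil_or_concat {u v : V} {p : List E} (h : G.IsPath u p v) :
    p = [] ∨ ∃ q g, p = q ++ [g] ∧ G.head g = v ∧ G.IsPath u q (G.tail g) := by
  rcases p.eq_nil_or_concat with rfl | ⟨q, g, rfl⟩
  · exact Or.inl rfl
  · obtain ⟨m, hm, hm'⟩ := isPath_append.1 (List.concat_eq_append ▸ h)
    obtain ⟨rfl, hg⟩ := hm'
    exact Or.inr ⟨q, g, by simp, hg, hm⟩

theorem IsPath.eq_nil_of_isSource {u v : V} {p : List E} (h : G.IsPath u p v)
    (hv : G.IsSource v) : p = [] := by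
  rcases h.eq_nil_or_concat with h' | ⟨q, g, -, hg, -⟩
  · exact h'
  · exact absurd hg (hv g)

theorem Route.finite [Finite V] [Finite E] (hG : G.Acyclic) : Finite G.Route := by
  cases nonempty_fintype E
  let f : G.Route → V × V × {l : List E // l.Nodup} :=
    fun p => (p.start, p.finish, ⟨p.edges, p.isPath.nodup hG⟩)
  refine Finite.of_injective f fun p q h => ?_
  simp only [f, Prod.mk.injEq, Subtype.mk.injEq] at h
  exact Route.ext h.1 h.2.1 h.2.2

variable (G) in
/-- There is a nontrivial path from `u` to `v`. -/
def Reaches (u v : V) : Prop := ∃ p, p ≠ [] ∧ G.IsPath u p v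

theorem Reaches.trans {u v w : V} (h : G.Reaches u v) (h' : G.Reaches v w) : G.Reaches u w := by
  obtain ⟨p, hp, hp'⟩ := h
  obtain ⟨q, -, hq'⟩ := h'
  exact ⟨p ++ q, by simp [hp], hp'.append hq'⟩

theorem reaches_edge (e : E) : G.Reaches (G.tail e) (G.head e) :=
  ⟨[e], by simp, rfl, rfl⟩

/-- Induction on this relation runs forwards from the sources; on the swapped relation below it runs
backwards from the sinks. -/
theorem Acyclic.wellFounded_reaches [Finite V] (hG : G.Acyclic) : WellFounded G.Reaches := by
  have : IsTrans V G.Reaches := ⟨fun _ _ _ => Reaches.trans⟩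
  have : Std.Irrefl G.Reaches := ⟨fun v ⟨p, hp, h⟩ => hp (hG v p h)⟩
  exact Finite.wellFounded_of_trans_of_irrefl _

theorem Acyclic.wellFounded_swap_reaches [Finite V] (hG : G.Acyclic) :
    WellFounded (Function.swap G.Reaches) := by
  have : IsTrans V (Function.swap G.Reaches) := ⟨fun _ _ _ h h' => Reaches.trans h' h⟩
  have : Std.Irrefl (Function.swap G.Reaches) := ⟨fun v ⟨p, hp, h⟩ => hp (hG v p h)⟩
  exact Finite.wellFounded_of_trans_of_irrefl _

/-- The paths from a vertex to the sinks. -/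
noncomputable def pathsFrom [Fintype E] (G : DirGraph V E) (v : V) : Finset (List E) :=
  ((Finset.univ : Finset {l : List E // l.Nodup}).map (Function.Embedding.subtype _)).filter
    fun q => ∃ t, G.IsSink t ∧ G.IsPath v q t

theorem mem_pathsFrom [Fintype E] (hG : G.Acyclic) {v : V} {q : List E} :
    q ∈ G.pathsFrom v ↔ ∃ t, G.IsSink t ∧ G.IsPath v q t := by
  simp only [pathsFrom, Finset.mem_filter, Finset.mem_map, Finset.mem_univ, true_and,
    Function.Embedding.subtype_apply, Subtype.exists, exists_prop, exists_eq_right]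
  exact ⟨fun h => h.2, fun h => ⟨h.choose_spec.2.nodup hG, h⟩⟩

theorem nil_mem_pathsFrom [Fintype E] (hG : G.Acyclic) {v : V} :
    [] ∈ G.pathsFrom v ↔ G.IsSink v := by
  rw [mem_pathsFrom hG]
  exact ⟨fun ⟨_, ht, h⟩ => Eq.symm h ▸ ht, fun h => ⟨v, h, rfl⟩⟩

theorem cons_mem_pathsFrom [Fintype E] (hG : G.Acyclic) {v : V} {e : E} {q : List E} :
    e :: q ∈ G.pathsFrom v ↔ G.tail e = v ∧ q ∈ G.pathsFrom (G.head e) := by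
  simp only [mem_pathsFrom hG, IsPath]
  constructor
  · rintro ⟨t, ht, h, h'⟩
    exact ⟨h, t, ht, h'⟩
  · rintro ⟨h, t, ht, h'⟩
    exact ⟨t, ht, h, h'⟩

theorem pathsFrom_of_isSink [Fintype E] (hG : G.Acyclic) {v : V} (hv : G.IsSink v) :
    G.pathsFrom v = {[]} := by
  ext q
  rw [Finset.mem_singleton]
  constructor
  · intro h
    obtain ⟨t, -, ht⟩ := (mem_pathsFrom hG).1 h
    exact ht.eq_nil_of_isSink hv
  · rintro rfl
    exact (nil_mem_pathsFrom hG).2 hv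

theorem sum_pathsFrom_of_not_isSink [Fintype E] (hG : G.Acyclic) {v : V} (hv : ¬ G.IsSink v)
    (w : List E → ℝ) :
    ∑ q ∈ G.pathsFrom v, w q =
      ∑ e with G.tail e = v, ∑ q ∈ G.pathsFrom (G.head e), w (e :: q) := by
  rw [Finset.sum_sigma']
  symm
  refine Finset.sum_bij (fun x _ => x.1 :: x.2) ?_ ?_ ?_ (fun _ _ => rfl)
  · rintro ⟨e, q⟩ h
    simp only [Finset.mem_sigma, Finset.mem_filter, Finset.mem_univ, true_and] at h
    exact (cons_mem_pathsFrom hG).2 h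
  · rintro ⟨e, q⟩ - ⟨e', q'⟩ - h
    simp only [List.cons.injEq] at h
    obtain ⟨rfl, rfl⟩ := h
    rfl
  · intro q hq
    cases q with
    | nil => exact absurd ((nil_mem_pathsFrom hG).1 hq) hv
    | cons e q =>
      refine ⟨⟨e, q⟩, ?_, rfl⟩
      simpa using (cons_mem_pathsFrom hG).1 hq

theorem mem_pathsFrom_append [Fintype E] (hG : G.Acyclic) {u v : V} {p q : List E}
    (hp : G.IsPath u p v) (hq : q ∈ G.pathsFrom v) : p ++ q ∈ G.pathsFrom u := by
  obtain ⟨t, ht, h⟩ := (mem_pathsFrom hG).1 hq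
  exact (mem_pathsFrom hG).2 ⟨t, ht, hp.append h⟩

end DirGraph

/-! ### The order on the paths from a vertex to the sinks. -/

section Orders

variable {V E : Type*} {G : DirGraph V E} {F : FramingData V E}

theorem FramingData.postLt_cons {e e' : E} {p q : List E} :
    F.PostLt (e :: p) (e' :: q) ↔ (e ≠ e' ∧ F.outLt e e') ∨ (e = e' ∧ F.PostLt p q) := by
  constructor
  · rintro ⟨σ, p₁, q₁, f, g, hp, hq, hne, hlt⟩
    cases σ with
    | nil =>
      simp only [List.nil_append, List.cons.injEq] at hp hq
      obtain ⟨rfl, rfl⟩ := hp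
      obtain ⟨rfl, rfl⟩ := hq
      exact Or.inl ⟨hne, hlt⟩
    | cons x σ =>
      simp only [List.cons_append, List.cons.injEq] at hp hq
      exact Or.inr ⟨hp.1.trans hq.1.symm, σ, p₁, q₁, f, g, hp.2, hq.2, hne, hlt⟩
  · rintro (⟨hne, hlt⟩ | ⟨rfl, σ, p₁, q₁, f, g, rfl, rfl, hne, hlt⟩)
    · exact ⟨[], p, q, e, e', rfl, rfl, hne, hlt⟩
    · exact ⟨e :: σ, p₁, q₁, f, g, rfl, rfl, hne, hlt⟩

theorem FramingData.not_postLt_nil_left {q : List E} : ¬ F.PostLt [] q := by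
  rintro ⟨σ, p₁, q₁, f, g, hp, -⟩
  simp at hp

theorem FramingData.not_postLt_nil_right {q : List E} : ¬ F.PostLt q [] := by
  rintro ⟨σ, p₁, q₁, f, g, -, hp, -⟩
  simp at hp

theorem FramingData.PostLt.append_left {p q : List E} (h : F.PostLt p q) (σ : List E) :
    F.PostLt (σ ++ p) (σ ++ q) := by
  obtain ⟨τ, p₁, q₁, f, g, rfl, rfl, h⟩ := h
  exact ⟨σ ++ τ, p₁, q₁, f, g, by simp, by simp, h⟩

/-- The properties of a framing that are used in all arguments. -/
structure IsFramed (G : DirGraph V E) (b : V → ℤ) (F : FramingData V E) : Prop where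
  out : ∀ i, TotalOrderOn (fun e f => e ≠ f ∧ F.outLt e f) (G.outEdges i)
  inc : ∀ i, ¬ G.IsSink i → TotalOrderOn (fun e f => e ≠ f ∧ F.inLt e f) (G.inEdges i)
  src : TotalOrderOn F.srcLt {s | G.IsSource s ∧ b s = 1}

theorem FramingData.postLt_irrefl (p : List E) : ¬ F.PostLt p p := by
  induction p with
  | nil => exact F.not_postLt_nil_left
  | cons e p ih =>
    rw [F.postLt_cons]
    rintro (⟨h, -⟩ | ⟨-, h⟩)
    · exact h rfl
    · exact ih h

/-- A lexicographic order. It is total because a path that ends at a sink cannot be a proper initial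
part of another path. -/
theorem IsFramed.totalOrderOn_postLt [Fintype E] {b : V → ℤ} (hF : IsFramed G b F)
    (hG : G.Acyclic) (v : V) : TotalOrderOn F.PostLt (G.pathsFrom v : Set (List E)) where
  irrefl := fun p _ => F.postLt_irrefl p
  trans := by
    intro p hp q hq r hr hpq hqr
    induction p generalizing v q r with
    | nil => exact absurd hpq F.not_postLt_nil_left
    | cons e p ih =>
      cases q with
      | nil => exact absurd hpq F.not_postLt_nil_right
      | cons f q =>
        cases r with
        | nil => exact absurd hqr F.not_postLt_nil_right
        | cons g r =>
          rw [SetLike.mem_coe, DirGraph.cons_mem_pathsFrom hG] at hp hq hr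
          rw [F.postLt_cons] at hpq hqr ⊢
          rcases hpq with h | ⟨rfl, h⟩ <;> rcases hqr with h' | ⟨rfl, h'⟩
          · exact Or.inl ((hF.out v).trans e hp.1 f hq.1 g hr.1 h h')
          · exact Or.inl h
          · exact Or.inl h'
          · exact Or.inr ⟨rfl, ih _ hp.2 q hq.2 r hr.2 h h'⟩
  total := by
    intro p hp q hq hne
    induction p generalizing v q with
    | nil =>
      have := (DirGraph.nil_mem_pathsFrom hG).1 hp
      rw [DirGraph.pathsFrom_of_isSink hG this] at hq
      exact absurd (by simpa using hq : q = []).symm hne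
    | cons e p ih =>
      cases q with
      | nil =>
        have := (DirGraph.nil_mem_pathsFrom hG).1 hq
        rw [DirGraph.pathsFrom_of_isSink hG this] at hp
        simp at hp
      | cons f q =>
        rw [SetLike.mem_coe, DirGraph.cons_mem_pathsFrom hG] at hp hq
        rw [F.postLt_cons, F.postLt_cons]
        by_cases hef : e = f
        · subst hef
          exact (ih _ hp.2 q hq.2 (by simpa using hne)).imp (fun h => Or.inr ⟨rfl, h⟩)
            (fun h => Or.inr ⟨rfl, h⟩)
        · exact ((hF.out v).total e hp.1 f hq.1 hef).imp Or.inl Or.inl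

end Orders

/-! ### Sums over the routes with a given suffix. -/

section Suffixes

variable {V E : Type*} {G : DirGraph V E}

theorem DirGraph.Route.edges_mem_pathsFrom [Fintype E] (hG : G.Acyclic) (P : G.Route) :
    P.edges ∈ G.pathsFrom P.start :=
  (DirGraph.mem_pathsFrom hG).2 ⟨P.finish, P.finish_isSink, P.isPath⟩

/-- The route passes through the vertex `v` and continues from there along `q`. -/
def DirGraph.Route.HasSuffix (P : G.Route) (v : V) (q : List E) : Prop :=
  ∃ l, P.edges = l ++ q ∧ G.IsPath P.start l v

theorem DirGraph.Route.HasSuffix.isPath {P : G.Route} {v : V} {q : List E}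
    (h : P.HasSuffix v q) : G.IsPath v q P.finish := by
  obtain ⟨l, hl, hp⟩ := h
  have := P.isPath
  rw [hl, DirGraph.isPath_append] at this
  obtain ⟨m, hm, hm'⟩ := this
  exact hp.end_unique hm ▸ hm'

theorem DirGraph.Route.HasSuffix.mem_pathsFrom [Fintype E] (hG : G.Acyclic) {P : G.Route} {v : V}
    {q : List E} (h : P.HasSuffix v q) : q ∈ G.pathsFrom v :=
  (DirGraph.mem_pathsFrom hG).2 ⟨P.finish, P.finish_isSink, h.isPath⟩

theorem DirGraph.Route.hasSuffix_source {P : G.Route} {s : V} {q : List E} (hs : G.IsSource s) :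
    P.HasSuffix s q ↔ P.start = s ∧ P.edges = q := by
  constructor
  · rintro ⟨l, hl, hp⟩
    obtain rfl := hp.eq_nil_of_isSource hs
    exact ⟨hp, hl⟩
  · rintro ⟨h, h'⟩
    exact ⟨[], h', h⟩

theorem DirGraph.Route.hasSuffix_nil {P : G.Route} {t : V} :
    P.HasSuffix t [] ↔ P.finish = t := by
  constructor
  · intro h
    exact h.isPath.symm
  · rintro rfl
    exact ⟨P.edges, by simp, P.isPath⟩

theorem DirGraph.Route.HasSuffix.tail {P : G.Route} {g : E} {q : List E}
    (h : P.HasSuffix (G.tail g) (g :: q)) : P.HasSuffix (G.head g) q := by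
  obtain ⟨l, hl, hp⟩ := h
  exact ⟨l ++ [g], by simp [hl], hp.append ⟨rfl, rfl⟩⟩

theorem DirGraph.Route.HasSuffix.exists_cons {P : G.Route} {v : V} {q : List E}
    (h : P.HasSuffix v q) (hv : ¬ G.IsSource v) :
    ∃ g, G.head g = v ∧ P.HasSuffix (G.tail g) (g :: q) := by
  obtain ⟨l, hl, hp⟩ := h
  rcases hp.eq_nil_or_concat with rfl | ⟨l', g, rfl, hg, hl'⟩
  · exact absurd (Eq.subst (motive := G.IsSource) hp P.start_isSource) hv
  · exact ⟨g, hg, l', by simp [hl], hl'⟩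

theorem DirGraph.Route.HasSuffix.cons_unique {P : G.Route} {v v' : V} {q : List E} {g g' : E}
    (h : P.HasSuffix v (g :: q)) (h' : P.HasSuffix v' (g' :: q)) : g = g' := by
  obtain ⟨l, hl, -⟩ := h
  obtain ⟨l', hl', -⟩ := h'
  rw [hl] at hl'
  have := (List.append_inj' hl' (by simp)).2
  simpa using this

/-- A route that passes through a vertex that is not a source enters it by exactly one edge. -/
theorem DirGraph.sum_hasSuffix_cons [Fintype E] [Fintype G.Route] {v : V} (hv : ¬ G.IsSource v)
    (q : List E) (c : G.Route → ℝ) :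
    ∑ g with G.head g = v, ∑ P : G.Route with P.HasSuffix (G.tail g) (g :: q), c P =
      ∑ P : G.Route with P.HasSuffix v q, c P := by
  simp_rw [Finset.sum_filter (fun P : G.Route => P.HasSuffix _ _)]
  rw [Finset.sum_comm]
  refine Finset.sum_congr rfl fun P _ => ?_
  by_cases h : P.HasSuffix v q
  · obtain ⟨g, hg, hgP⟩ := h.exists_cons hv
    rw [if_pos h, Finset.sum_eq_single g, if_pos hgP]
    · intro g' _ hne
      rw [if_neg]
      exact fun h' => hne (h'.cons_unique hgP)
    · simp [hg]
  · rw [if_neg h, Finset.sum_eq_zero]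
    intro g hg
    rw [if_neg]
    intro h'
    simp only [Finset.mem_filter, Finset.mem_univ, true_and] at hg
    exact h (hg ▸ h'.tail)

/-- A route uses `g` at most once, by acyclicity, and then has exactly one continuation after `g`.
-/
theorem DirGraph.sum_hasSuffix_count [Fintype E] [Fintype G.Route] (hG : G.Acyclic)
    (g : E) (c : G.Route → ℝ) :
    ∑ q ∈ G.pathsFrom (G.head g), ∑ P : G.Route with P.HasSuffix (G.tail g) (g :: q), c P =
      ∑ P : G.Route, c P * (P.edges.count g : ℝ) := by
  simp_rw [Finset.sum_filter]
  rw [Finset.sum_comm]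
  refine Finset.sum_congr rfl fun P _ => ?_
  by_cases h : g ∈ P.edges
  · rw [List.count_eq_one_of_mem (P.isPath.nodup hG) h, Nat.cast_one, mul_one]
    obtain ⟨l, r, hlr⟩ := List.append_of_mem h
    have hP := P.isPath
    rw [hlr, DirGraph.isPath_append] at hP
    obtain ⟨m, hm, rfl, hr⟩ := hP
    have hs : P.HasSuffix (G.tail g) (g :: r) := ⟨l, hlr, hm⟩
    rw [Finset.sum_eq_single r, if_pos hs]
    · intro r' _ hne
      rw [if_neg]
      rintro ⟨l', hl', -⟩
      apply hne
      have hn := P.isPath.nodup hG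
      rw [hlr] at hl' hn
      rcases List.append_eq_append_iff.1 hl' with ⟨a, h1, h2⟩ | ⟨a, h1, h2⟩
      · cases a with
        | nil => simpa using h2.symm
        | cons x a =>
          simp only [List.cons_append, List.cons.injEq] at h2
          exact absurd hn (by simp [List.nodup_append, h2.2])
      · cases a with
        | nil => simpa using h2
        | cons x a =>
          simp only [List.cons_append, List.cons.injEq] at h2
          rw [h1] at hn
          exact absurd hn (by simp [List.nodup_append, h2.1])
    · intro hr'
      exact absurd ((DirGraph.mem_pathsFrom hG).2 ⟨_, P.finish_isSink, hr⟩) hr'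
  · rw [List.count_eq_zero_of_not_mem h, Nat.cast_zero, mul_zero, Finset.sum_eq_zero]
    intro q _
    rw [if_neg]
    rintro ⟨l, hl, -⟩
    exact h (by simp [hl])

theorem DirGraph.sum_hasSuffix_source [Fintype G.Route] {s : V} {q : List E}
    (hs : G.IsSource s) {t : V} (ht : G.IsSink t) (hq : G.IsPath s q t) (c : G.Route → ℝ) :
    ∑ P : G.Route with P.HasSuffix s q, c P = c ⟨s, t, q, hq, hs, ht⟩ := by
  have : (Finset.univ.filter fun P : G.Route => P.HasSuffix s q) = {⟨s, t, q, hq, hs, ht⟩} := by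
    ext P
    simp only [Finset.mem_filter, Finset.mem_univ, true_and, Finset.mem_singleton,
      DirGraph.Route.hasSuffix_source hs]
    constructor
    · rintro ⟨h1, h2⟩
      refine DirGraph.Route.ext h1 ?_ h2
      have := P.isPath
      rw [h1, h2] at this
      exact this.end_unique hq
    · rintro rfl
      exact ⟨rfl, rfl⟩
  rw [this, Finset.sum_singleton]

end Suffixes

/-! ### Flows correspond to weights on route-cliques. -/

section Decomposition

variable {V E : Type*} {G : DirGraph V E} {b : V → ℤ} {F : FramingData V E}

/-- The netflow vectors that are `0` or `1` at sources, nonpositive at sinks and zero elsewhere. -/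
structure IsUnitSupply (G : DirGraph V E) (b : V → ℤ) : Prop where
  source : ∀ i, G.IsSource i → b i = 0 ∨ b i = 1
  sink : ∀ i, G.IsSink i → b i ≤ 0
  internal : ∀ i, G.IsInternal i → b i = 0

/-- A weight function on routes, supported on a route-clique, that induces the flow `f`. -/
structure IsCliqueDecomposition [Fintype G.Route] (b : V → ℤ) (F : FramingData V E)
    (f : E → ℝ) (c : G.Route → ℝ) : Prop where
  nonneg : ∀ P, 0 ≤ c P
  clique : F.IsRouteClique {P | 0 < c P}
  edge : ∀ e, ∑ P, c P * (P.edges.count e : ℝ) = f e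
  start : ∀ s, G.IsSource s → ∑ P : G.Route with P.start = s, c P = b s
  finish : ∀ t, G.IsSink t → ∑ P : G.Route with P.finish = t, c P = -b t

/-- Numerical ranks for the orders on the paths from each vertex and on the edges into it. -/
structure IsRanking [Fintype E] (G : DirGraph V E) (F : FramingData V E)
    (π : V → List E → ℕ) (ρ : V → E → ℕ) : Prop where
  injOn_path : ∀ v, Set.InjOn (π v) (G.pathsFrom v : Set (List E))
  path : ∀ v, ∀ p ∈ G.pathsFrom v, ∀ q ∈ G.pathsFrom v, F.PostLt p q ↔ π v p < π v q
  injOn_edge : ∀ v, Set.InjOn (ρ v) (G.inEdges v)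
  edge : ∀ v, ¬ G.IsSink v → ∀ e ∈ G.inEdges v, ∀ g ∈ G.inEdges v,
    (e ≠ g ∧ F.inLt e g) ↔ ρ v e < ρ v g

theorem IsFramed.exists_isRanking [Fintype E] (hF : IsFramed G b F) (hG : G.Acyclic) :
    ∃ π ρ, IsRanking G F π ρ := by
  have h1 := fun v => (hF.totalOrderOn_postLt hG v).exists_rank (Finset.finite_toSet _)
  choose π hπ hπ' using h1
  have h2 : ∀ v, ∃ ρ : E → ℕ, Set.InjOn ρ (G.inEdges v) ∧ (¬ G.IsSink v →
      ∀ e ∈ G.inEdges v, ∀ g ∈ G.inEdges v, (e ≠ g ∧ F.inLt e g) ↔ ρ e < ρ g) := by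
    intro v
    by_cases hv : G.IsSink v
    -- A framing need not order the edges into a sink. Any injective rank serves there, since a sink
    -- has only the empty path and its coupling a single row.
    · exact ⟨fun e => (Fintype.equivFin E e : ℕ),
        fun x _ y _ h => (Fintype.equivFin E).injective (Fin.ext h), fun h => absurd hv h⟩
    · obtain ⟨ρ, h, h'⟩ := (hF.inc v hv).exists_rank (Set.toFinite _)
      exact ⟨ρ, h, fun _ => h'⟩
  choose ρ hρ hρ' using h2
  exact ⟨π, ρ, hπ, hπ', hρ, hρ'⟩

/-- Weights on the paths from each vertex to the sinks that are compatible with the flow `f`, and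
such that at each vertex the joint weights of incoming edges and outgoing paths form a chain. -/
structure IsSuffixWeight [Fintype E] (G : DirGraph V E) (b : V → ℤ) (π : V → List E → ℕ)
    (ρ : V → E → ℕ) (f : E → ℝ) (w : V → List E → ℝ) : Prop where
  nonneg : ∀ v, ∀ q ∈ G.pathsFrom v, 0 ≤ w v q
  sink : ∀ v, G.IsSink v → w v [] = -b v
  coupling : ∀ v, ¬ G.IsSource v → IsChainCoupling (π v) (ρ v) (G.pathsFrom v)
    (Finset.univ.filter fun g => G.head g = v) (w v) f (fun q g => w (G.tail g) (g :: q))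

/-- Backward induction from the sinks: the weights at the head of `g` and the flow are the margins
of the coupling there, whose entries are the weights at the tail. -/
theorem IsSuffixWeight.unique [Finite V] [Fintype E] {π : V → List E → ℕ} {ρ : V → E → ℕ}
    {f : E → ℝ} {w w' : V → List E → ℝ} (hG : G.Acyclic) (hr : IsRanking G F π ρ)
    (hw : IsSuffixWeight G b π ρ f w) (hw' : IsSuffixWeight G b π ρ f w') (v : V) :
    ∀ q ∈ G.pathsFrom v, w v q = w' v q := by
  induction v using hG.wellFounded_swap_reaches.induction with
  | h v ih =>
    intro q hq
    cases q with
    | nil =>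
      have hv := (DirGraph.nil_mem_pathsFrom hG).1 hq
      rw [hw.sink v hv, hw'.sink v hv]
    | cons g q =>
      obtain ⟨rfl, hq'⟩ := (DirGraph.cons_mem_pathsFrom hG).1 hq
      have hs : ¬ G.IsSource (G.head g) := fun h => h g rfl
      refine (hw.coupling _ hs).unique (hr.injOn_path _) ?_ (hw'.coupling _ hs)
        (ih _ (DirGraph.reaches_edge g)) q hq' g (by simp)
      intro x hx y hy h
      exact hr.injOn_edge (G.head g) (by simpa [DirGraph.inEdges] using hx)
        (by simpa [DirGraph.inEdges] using hy) h

/-- Two positive entries violating the chain condition at `v` would come from two routes of the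
support that cross at `v`. -/
theorem IsCliqueDecomposition.isSuffixWeight [Fintype E] [Fintype G.Route]
    {π : V → List E → ℕ} {ρ : V → E → ℕ} {f : E → ℝ} {c : G.Route → ℝ} (hG : G.Acyclic)
    (hr : IsRanking G F π ρ) (hc : IsCliqueDecomposition b F f c) :
    IsSuffixWeight G b π ρ f (fun v q => ∑ P : G.Route with P.HasSuffix v q, c P) where
  nonneg := fun v q _ => Finset.sum_nonneg fun P _ => hc.nonneg P
  sink := by
    intro v hv
    simp_rw [DirGraph.Route.hasSuffix_nil]
    exact hc.finish v hv
  coupling := by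
    intro v hv
    refine ⟨fun _ _ _ _ => Finset.sum_nonneg fun P _ => hc.nonneg P, ?_, ?_, ?_⟩
    · intro q _
      exact DirGraph.sum_hasSuffix_cons hv q c
    · intro g hg
      obtain rfl : G.head g = v := by simpa using hg
      rw [DirGraph.sum_hasSuffix_count hG, hc.edge]
    · intro q hq q' hq' g hg g' hg' hlt hlt'
      by_contra! hne
      obtain ⟨P, hP, hcP⟩ := Finset.exists_ne_zero_of_sum_ne_zero hne.1
      obtain ⟨Q, hQ, hcQ⟩ := Finset.exists_ne_zero_of_sum_ne_zero hne.2
      simp only [Finset.mem_filter, Finset.mem_univ, true_and] at hP hQ hg hg'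
      -- Two distinct continuations exclude a sink, so the ranks of the incoming edges reflect the
      -- framing.
      have hsink : ¬ G.IsSink v := by
        intro h
        rw [DirGraph.pathsFrom_of_isSink hG h, Finset.mem_singleton] at hq hq'
        rw [hq, hq'] at hlt
        exact lt_irrefl _ hlt
      have hpost := (hr.path v q hq q' hq').2 hlt
      have hin := (hr.edge v hsink g' hg' g hg).2 hlt'
      have hP' : G.IsPath v q P.finish := hg ▸ hP.tail.isPath
      have hQ' : G.IsPath v q' Q.finish := hg' ▸ hQ.tail.isPath
      obtain ⟨l, hl, hpl⟩ := hP
      obtain ⟨m, hm, hpm⟩ := hQ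
      refine (hc.clique Q (lt_of_le_of_ne (hc.nonneg Q) hcQ.symm) P
        (lt_of_le_of_ne (hc.nonneg P) hcP.symm) v).1 ?_
      exact ⟨m ++ [g'], q', l ++ [g], q, by simp [hm], hpm.append ⟨rfl, hg'⟩, hQ',
        by simp [hl], hpl.append ⟨rfl, hg⟩, hP', ⟨[], m, l, g', g, rfl, rfl, hin.1, hin.2⟩, hpost⟩

theorem DirGraph.Route.eq_sum_hasSuffix [Fintype G.Route] (c : G.Route → ℝ)
    (P : G.Route) : c P = ∑ Q : G.Route with Q.HasSuffix P.start P.edges, c Q :=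
  (DirGraph.sum_hasSuffix_source P.start_isSource P.finish_isSink P.isPath c).symm

/-- A route weight is the suffix weight of the whole route at its source, and suffix weights are
unique. -/
theorem IsCliqueDecomposition.unique [Finite V] [Fintype E] [Fintype G.Route]
    {f : E → ℝ} {c c' : G.Route → ℝ} (hG : G.Acyclic) (hF : IsFramed G b F)
    (hc : IsCliqueDecomposition b F f c) (hc' : IsCliqueDecomposition b F f c') : c = c' := by
  obtain ⟨π, ρ, hr⟩ := hF.exists_isRanking hG
  funext P
  rw [DirGraph.Route.eq_sum_hasSuffix c P, DirGraph.Route.eq_sum_hasSuffix c' P]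
  exact (hc.isSuffixWeight hG hr).unique hG hr (hc'.isSuffixWeight hG hr) _ _
    (P.edges_mem_pathsFrom hG)

/-- A chain coupling at the vertex `v`, if there is one. -/
noncomputable def vertexCoupling [Fintype E] (G : DirGraph V E) (π : V → List E → ℕ)
    (ρ : V → E → ℕ) (f : E → ℝ) (v : V) (r : List E → ℝ) : List E → E → ℝ :=
  if h : ∃ M, IsChainCoupling (π v) (ρ v) (G.pathsFrom v)
    (Finset.univ.filter fun g => G.head g = v) r f M then h.choose else 0

/-- Well-founded recursion from the sinks. That the couplings exist is not yet known, hence the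
default value in `vertexCoupling`. -/
theorem exists_vertexCoupling_eq [Finite V] [Fintype E] (hG : G.Acyclic) (b : V → ℤ)
    (π : V → List E → ℕ) (ρ : V → E → ℕ) (f : E → ℝ) :
    ∃ w : V → List E → ℝ, (∀ v, w v [] = -b v) ∧
      ∀ g q, w (G.tail g) (g :: q) =
        vertexCoupling G π ρ f (G.head g) (w (G.head g)) q g := by
  let step : (u : V) → ((v : V) → Function.swap G.Reaches v u → List E → ℝ) → List E → ℝ :=
    fun u IH q => match q with
    | [] => -b u
    | g :: q => if h : G.tail g = u then
        vertexCoupling G π ρ f (G.head g) (IH (G.head g) (h ▸ DirGraph.reaches_edge g)) q g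
      else 0
  refine ⟨hG.wellFounded_swap_reaches.fix step, fun v => ?_, fun g q => ?_⟩
  · rw [WellFounded.fix_eq]
  · rw [WellFounded.fix_eq]
    exact dif_pos rfl

theorem exists_isSuffixWeight [Finite V] [Fintype E] (hG : G.Acyclic) (hb : IsUnitSupply G b)
    (π : V → List E → ℕ) (ρ : V → E → ℕ) {f : E → ℝ} (hf : f ∈ G.flowPolytope b) :
    ∃ w, IsSuffixWeight G b π ρ f w ∧ ∀ s, G.IsSource s → ∑ q ∈ G.pathsFrom s, w s q = b s := by
  obtain ⟨w, hw, hw'⟩ := exists_vertexCoupling_eq hG b π ρ f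
  obtain ⟨hf0, hfb⟩ := hf
  -- Conservation of flow makes the row total at `v` equal to the column total, so the chosen matrix
  -- really is a coupling.
  have hcoup : ∀ v, ¬ G.IsSource v → (∀ q ∈ G.pathsFrom v, 0 ≤ w v q) →
      ∑ q ∈ G.pathsFrom v, w v q =
        (if G.IsSink v then -(b v : ℝ) else ∑ e with G.tail e = v, f e) →
      IsChainCoupling (π v) (ρ v) (G.pathsFrom v)
        (Finset.univ.filter fun g => G.head g = v) (w v) f (fun q g => w (G.tail g) (g :: q)) := by
    intro v hv h0 hsum
    have hex : ∃ M, IsChainCoupling (π v) (ρ v) (G.pathsFrom v)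
        (Finset.univ.filter fun g => G.head g = v) (w v) f M := by
      refine exists_isChainCoupling _ _ _ _ _ rfl _ _ h0 (fun e _ => hf0 e) ?_
      rw [hsum]
      have := hfb v
      split_ifs with hs
      · have h0 : ∑ e with G.tail e = v, f e = 0 :=
          Finset.sum_eq_zero fun e he => absurd (by simpa using he) (hs e)
        linarith
      · rw [hb.internal v ⟨hv, hs⟩] at this
        push_cast at this
        linarith
    have hM := hex.choose_spec
    have : ∀ q, ∀ g ∈ Finset.univ.filter (fun g => G.head g = v),
        w (G.tail g) (g :: q) = hex.choose q g := by
      intro q g hg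
      obtain rfl : G.head g = v := by simpa using hg
      rw [hw', vertexCoupling, dif_pos hex]
    refine ⟨?_, ?_, ?_, ?_⟩
    · intro q hq g hg
      rw [this q g hg]
      exact hM.nonneg q hq g hg
    · intro q hq
      rw [Finset.sum_congr rfl (this q), hM.row q hq]
    · intro g hg
      rw [Finset.sum_congr rfl fun q _ => this q g hg, hM.col g hg]
    · intro q hq q' hq' g hg g' hg'
      rw [this q g hg, this q' g' hg']
      exact hM.chain q hq q' hq' g hg g' hg'
  -- Summing the column sums of the couplings at the heads of the outgoing edges gives the outflow
  -- at `v`, which is the total that `hcoup` needs.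
  have hmain : ∀ v, (∀ q ∈ G.pathsFrom v, 0 ≤ w v q) ∧ ∑ q ∈ G.pathsFrom v, w v q =
      (if G.IsSink v then -(b v : ℝ) else ∑ e with G.tail e = v, f e) := by
    intro v
    induction v using hG.wellFounded_swap_reaches.induction with
    | h v ih =>
      by_cases hv : G.IsSink v
      · rw [DirGraph.pathsFrom_of_isSink hG hv]
        have : (b v : ℝ) ≤ 0 := by exact_mod_cast hb.sink v hv
        simp [hv, hw, this]
      · have hc : ∀ g, G.tail g = v → IsChainCoupling (π (G.head g)) (ρ (G.head g))
            (G.pathsFrom (G.head g)) (Finset.univ.filter fun g' => G.head g' = G.head g)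
            (w (G.head g)) f (fun q g => w (G.tail g) (g :: q)) := by
          rintro g rfl
          obtain ⟨h1, h2⟩ := ih _ (DirGraph.reaches_edge g)
          exact hcoup _ (fun h => h g rfl) h1 h2
        constructor
        · intro q hq
          cases q with
          | nil => exact absurd ((DirGraph.nil_mem_pathsFrom hG).1 hq) hv
          | cons g q =>
            obtain ⟨rfl, hq'⟩ := (DirGraph.cons_mem_pathsFrom hG).1 hq
            exact (hc g rfl).nonneg q hq' g (by simp)
        · rw [if_neg hv, DirGraph.sum_pathsFrom_of_not_isSink hG hv]
          refine Finset.sum_congr rfl fun g hg => ?_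
          obtain rfl : G.tail g = v := by simpa using hg
          exact (hc g rfl).col g (by simp)
  refine ⟨w, ⟨fun v => (hmain v).1, fun v _ => hw v,
    fun v hv => hcoup v hv (hmain v).1 (hmain v).2⟩, fun s hs => ?_⟩
  rw [(hmain s).2]
  have := hfb s
  have h0 : ∑ e with G.head e = s, f e = 0 :=
    Finset.sum_eq_zero fun e he => absurd (by simpa using he) (hs e)
  split_ifs with ht
  · have h1 : ∑ e with G.tail e = s, f e = 0 :=
      Finset.sum_eq_zero fun e he => absurd (by simpa using he) (ht e)
    linarith
  · linarith

/-- Forward induction from the sources, where a suffix is a whole route; the row sums of the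
couplings carry the identity across a vertex. -/
theorem IsSuffixWeight.sum_hasSuffix [Finite V] [Fintype E] [Fintype G.Route]
    {π : V → List E → ℕ} {ρ : V → E → ℕ} {f : E → ℝ} {w : V → List E → ℝ} (hG : G.Acyclic)
    (hw : IsSuffixWeight G b π ρ f w) (v : V) :
    ∀ q ∈ G.pathsFrom v, ∑ P : G.Route with P.HasSuffix v q, w P.start P.edges = w v q := by
  induction v using hG.wellFounded_reaches.induction with
  | h v ih =>
    intro q hq
    by_cases hv : G.IsSource v
    · obtain ⟨t, ht, h⟩ := (DirGraph.mem_pathsFrom hG).1 hq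
      exact DirGraph.sum_hasSuffix_source hv ht h (fun P => w P.start P.edges)
    · rw [← DirGraph.sum_hasSuffix_cons hv, ← (hw.coupling v hv).row q hq]
      refine Finset.sum_congr rfl fun g hg => ?_
      obtain rfl : G.head g = v := by simpa using hg
      exact ih _ (DirGraph.reaches_edge g) _ ((DirGraph.cons_mem_pathsFrom hG).2 ⟨rfl, hq⟩)

/-- A row sum is at least each of its entries, so removing the first edge keeps the weight positive.
-/
theorem IsSuffixWeight.pos_of_append [Fintype E] {π : V → List E → ℕ}
    {ρ : V → E → ℕ} {f : E → ℝ} {w : V → List E → ℝ} (hG : G.Acyclic)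
    (hw : IsSuffixWeight G b π ρ f w) {u v : V} {l q : List E} (hl : G.IsPath u l v)
    (hq : q ∈ G.pathsFrom v) (hpos : 0 < w u (l ++ q)) : 0 < w v q := by
  induction l generalizing u with
  | nil =>
    obtain rfl : u = v := hl
    exact hpos
  | cons g l ih =>
    obtain ⟨rfl, hl⟩ := hl
    refine ih hl ?_
    have hs : ¬ G.IsSource (G.head g) := fun h => h g rfl
    have hmem := DirGraph.mem_pathsFrom_append hG hl hq
    rw [← (hw.coupling _ hs).row _ hmem]
    exact Finset.sum_pos' (fun g' hg' => (hw.coupling _ hs).nonneg _ hmem g' hg')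
      ⟨g, by simp, hpos⟩

theorem IsSuffixWeight.not_crossAt [Fintype E] {π : V → List E → ℕ}
    {ρ : V → E → ℕ} {f : E → ℝ} {w : V → List E → ℝ} (hG : G.Acyclic)
    (hr : IsRanking G F π ρ) (hw : IsSuffixWeight G b π ρ f w) {P Q : G.Route}
    (hP : 0 < w P.start P.edges) (hQ : 0 < w Q.start Q.edges) (i : V) : ¬ F.CrossAt i P Q := by
  rintro ⟨p₁, p₂, q₁, q₂, hp, hp₁, hp₂, hq, hq₁, hq₂, ⟨σ, p₀, q₀, e, g, rfl, rfl, hne, hin⟩, hpost⟩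
  obtain ⟨x, hx, rfl, hσ⟩ := DirGraph.isPath_append.1 hp₁
  obtain ⟨y, hy, rfl, hσ'⟩ := DirGraph.isPath_append.1 hq₁
  -- The crossing is moved back along the common part `σ` to the vertex where `e` and `g` enter;
  -- there it contradicts the chain condition.
  have hpost := hpost.append_left σ
  have hp' : p₂ ∈ G.pathsFrom i := (DirGraph.mem_pathsFrom hG).2 ⟨_, P.finish_isSink, hp₂⟩
  have hq' : q₂ ∈ G.pathsFrom i := (DirGraph.mem_pathsFrom hG).2 ⟨_, Q.finish_isSink, hq₂⟩
  have hsp := DirGraph.mem_pathsFrom_append hG hσ hp'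
  have hsq := DirGraph.mem_pathsFrom_append hG hσ' hq'
  have hcomm : G.head g = G.head e := by
    cases σ with
    | nil => exact Eq.trans hσ' (Eq.symm hσ)
    | cons a σ => exact hσ'.1.symm.trans hσ.1
  have hsource : ¬ G.IsSource (G.head e) := fun h => h e rfl
  have hsink : ¬ G.IsSink (G.head e) := by
    intro h
    rw [DirGraph.pathsFrom_of_isSink hG h, Finset.mem_singleton] at hsp
    rw [hsp] at hpost
    exact F.not_postLt_nil_right hpost
  have hpos₁ : 0 < w (G.tail e) (e :: (σ ++ p₂)) := by
    refine hw.pos_of_append hG hx ((DirGraph.cons_mem_pathsFrom hG).2 ⟨rfl, hsp⟩) ?_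
    simpa [hp] using hP
  have hpos₂ : 0 < w (G.tail g) (g :: (σ ++ q₂)) := by
    refine hw.pos_of_append hG hy ((DirGraph.cons_mem_pathsFrom hG).2 ⟨rfl, hsq⟩) ?_
    simpa [hq] using hQ
  rw [hcomm] at hsq
  rcases (hw.coupling _ hsource).chain _ hsq _ hsp g (by simp [hcomm]) e (by simp)
    ((hr.path _ _ hsq _ hsp).1 hpost)
    ((hr.edge _ hsink _ rfl _ hcomm).1 ⟨hne, hin⟩) with h | h
  · exact hpos₂.ne' h
  · exact hpos₁.ne' h

theorem exists_isCliqueDecomposition [Finite V] [Fintype E] [Fintype G.Route] (hG : G.Acyclic)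
    (hb : IsUnitSupply G b) (hF : IsFramed G b F) {f : E → ℝ} (hf : f ∈ G.flowPolytope b) :
    ∃ c : G.Route → ℝ, IsCliqueDecomposition b F f c := by
  obtain ⟨π, ρ, hr⟩ := hF.exists_isRanking hG
  obtain ⟨w, hw, hws⟩ := exists_isSuffixWeight hG hb π ρ hf
  have hsum := fun v => hw.sum_hasSuffix hG v
  refine ⟨fun P => w P.start P.edges, fun P => hw.nonneg _ _ (P.edges_mem_pathsFrom hG),
    fun P hP Q hQ i => ⟨hw.not_crossAt hG hr hP hQ i, hw.not_crossAt hG hr hQ hP i⟩, ?_, ?_, ?_⟩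
  · intro e
    rw [← DirGraph.sum_hasSuffix_count hG, ← (hw.coupling (G.head e) fun h => h e rfl).col e
      (by simp)]
    exact Finset.sum_congr rfl fun q hq =>
      hsum _ _ ((DirGraph.cons_mem_pathsFrom hG).2 ⟨rfl, hq⟩)
  · intro s hs
    rw [← hws s hs, ← Finset.sum_congr rfl (hsum s)]
    simp_rw [DirGraph.Route.hasSuffix_source hs, Finset.sum_filter]
    rw [Finset.sum_comm]
    refine Finset.sum_congr rfl fun P _ => ?_
    by_cases h : P.start = s
    · have := P.edges_mem_pathsFrom hG
      rw [h] at this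
      simp [h, this]
    · simp [h]
  · intro t ht
    have := hsum t [] ((DirGraph.nil_mem_pathsFrom hG).2 ht)
    simp_rw [DirGraph.Route.hasSuffix_nil] at this
    rw [this, hw.sink t ht]

end Decomposition

/-! ### The total order on layerings. -/

section LayeringOrder

variable {V E : Type*} {G : DirGraph V E} {b : V → ℤ} {F : FramingData V E}

theorem IsLayering.supply_eq_one (hb : IsUnitSupply G b) {L : Finset G.Route}
    (hL : IsLayering G b L) {p : G.Route} (hp : p ∈ L) : b p.start = 1 := by
  rcases hb.source _ p.start_isSource with h | h
  · have := hL.source _ p.start_isSource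
    rw [h] at this
    have : (L.filter fun q => q.start = p.start) = ∅ := by simpa using this
    exact absurd hp fun h' => Finset.notMem_empty p (this ▸ Finset.mem_filter.2 ⟨h', rfl⟩)
  · exact h

theorem IsLayering.existsUnique_route {L : Finset G.Route} (hL : IsLayering G b L) {s : V}
    (hs : G.IsSource s) (hbs : b s = 1) : ∃ p, (p ∈ L ∧ p.start = s) ∧
      ∀ q ∈ L, q.start = s → q = p := by
  have := hL.source s hs
  rw [hbs] at this
  obtain ⟨p, hp⟩ := Finset.card_eq_one.1 (by exact_mod_cast this)
  have h1 : ∀ q, (q ∈ L ∧ q.start = s) ↔ q = p := by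
    intro q
    rw [← Finset.mem_singleton (a := p), ← hp, Finset.mem_filter]
  exact ⟨p, (h1 p).2 rfl, fun q hq hqs => (h1 q).1 ⟨hq, hqs⟩⟩

theorem IsLayering.eq_of_start_eq (hb : IsUnitSupply G b) {L : Finset G.Route}
    (hL : IsLayering G b L) {p q : G.Route} (hp : p ∈ L) (hq : q ∈ L) (h : p.start = q.start) :
    p = q := by
  obtain ⟨r, -, hr⟩ := hL.existsUnique_route q.start_isSource (hL.supply_eq_one hb hq)
  rw [hr p hp h, hr q hq rfl]

theorem DirGraph.Route.ext_edges {p q : G.Route} (hs : p.start = q.start)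
    (he : p.edges = q.edges) : p = q := by
  refine DirGraph.Route.ext hs ?_ he
  have := p.isPath
  rw [hs, he] at this
  exact this.end_unique q.isPath

theorem IsFramed.totalOrderOn_layeringLt [Finite V] [Fintype E] (hF : IsFramed G b F)
    (hG : G.Acyclic) (hb : IsUnitSupply G b) :
    TotalOrderOn F.LayeringLt {L | IsLayering G b L} where
  irrefl := by
    rintro L hL ⟨p, hp, q, hq, hs, hlt, -⟩
    obtain rfl := IsLayering.eq_of_start_eq hb hL hp hq hs
    exact F.postLt_irrefl _ hlt
  trans := by
    rintro L hL M hM K hK ⟨p, hp, q, hq, hs, hlt, hmax⟩ ⟨q', hq', r, hr, hs', hlt', hmax'⟩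
    have bp := IsLayering.supply_eq_one hb hL hp
    have bq' := IsLayering.supply_eq_one hb hM hq'
    have step : ∀ x ∈ L, ∀ z ∈ K, x.start = z.start → F.srcLt p.start x.start →
        F.srcLt q'.start x.start → x = z := by
      intro x hx z hz hxz h1 h2
      obtain ⟨y, ⟨hy, hys⟩, -⟩ := IsLayering.existsUnique_route hM x.start_isSource
        (IsLayering.supply_eq_one hb hL hx)
      rw [hmax x hx y hy hys.symm h1]
      exact hmax' y hy z hz (hys.trans hxz) (hys.symm ▸ h2)
    have src_trans : ∀ {u v : V} {x : G.Route}, x ∈ L → G.IsSource u → b u = 1 → G.IsSource v →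
        b v = 1 → F.srcLt u v → F.srcLt v x.start → F.srcLt u x.start :=
      fun hx hu hbu hv hbv h1 h2 => hF.src.trans _ ⟨hu, hbu⟩ _ ⟨hv, hbv⟩ _
        ⟨DirGraph.Route.start_isSource _, IsLayering.supply_eq_one hb hL hx⟩ h1 h2
    -- The greater of the two deciding sources decides between `L` and `K`.
    by_cases heq : p.start = q'.start
    · obtain rfl := IsLayering.eq_of_start_eq hb hM hq hq' (hs.symm.trans heq)
      refine ⟨p, hp, r, hr, hs.trans hs', ?_, fun x hx z hz hxz h => ?_⟩
      · refine (hF.totalOrderOn_postLt hG p.start).trans _ (p.edges_mem_pathsFrom hG) _ ?_ _ ?_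
          hlt hlt'
        · exact heq ▸ q.edges_mem_pathsFrom hG
        · exact (heq.trans hs') ▸ r.edges_mem_pathsFrom hG
      · exact step x hx z hz hxz h (heq ▸ h)
    · rcases hF.src.total _ ⟨p.start_isSource, bp⟩ _ ⟨q'.start_isSource, bq'⟩ heq with h | h
      · obtain ⟨p', ⟨hp', hps⟩, -⟩ := IsLayering.existsUnique_route hL q'.start_isSource bq'
        have : p' = q' := hmax p' hp' q' hq' hps (hps.symm ▸ h)
        subst this
        exact ⟨p', hp', r, hr, hs', hlt', fun x hx z hz hxz h2 => step x hx z hz hxz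
          (src_trans hx p.start_isSource bp p'.start_isSource bq' h h2) h2⟩
      · obtain ⟨r', ⟨hr', hrs⟩, -⟩ := IsLayering.existsUnique_route hK p.start_isSource bp
        have : q = r' := hmax' q hq r' hr' (hs.symm.trans hrs.symm) (hs ▸ h)
        subst this
        exact ⟨p, hp, q, hr', hs, hlt, fun x hx z hz hxz h2 => step x hx z hz hxz h2
          (src_trans hx q'.start_isSource bq' p.start_isSource bp h h2)⟩
  total := by
    intro L hL M hM hne
    let D : Set V := {s | ∃ p ∈ L, ∃ q ∈ M, p.start = s ∧ q.start = s ∧ p ≠ q}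
    have hsrc : D ⊆ {s | G.IsSource s ∧ b s = 1} := by
      rintro _ ⟨p, hp, q, hq, rfl, -, -⟩
      exact ⟨p.start_isSource, IsLayering.supply_eq_one hb hL hp⟩
    -- Reversing the order makes the greatest source of disagreement a least element of `D`.
    have hswap : TotalOrderOn (Function.swap F.srcLt) {s | G.IsSource s ∧ b s = 1} :=
      ⟨hF.src.irrefl, fun x hx y hy z hz h h' => hF.src.trans z hz y hy x hx h' h,
        fun x hx y hy h => (hF.src.total x hx y hy h).symm⟩
    have hD : D.Nonempty := by
      by_contra hD
      rw [Set.not_nonempty_iff_eq_empty] at hD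
      have key : ∀ p ∈ L, ∀ q ∈ M, p.start = q.start → p = q := by
        intro p hp q hq hpq
        by_contra h
        have : p.start ∈ D := ⟨p, hp, q, hq, rfl, hpq.symm, h⟩
        rw [hD] at this
        exact this
      apply hne
      ext p
      constructor
      · intro hp
        obtain ⟨q, ⟨hq, hqs⟩, -⟩ := IsLayering.existsUnique_route hM p.start_isSource
          (IsLayering.supply_eq_one hb hL hp)
        rwa [key p hp q hq hqs.symm]
      · intro hp
        obtain ⟨q, ⟨hq, hqs⟩, -⟩ := IsLayering.existsUnique_route hL p.start_isSource
          (IsLayering.supply_eq_one hb hM hp)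
        rwa [← key q hq p hp hqs]
    obtain ⟨s, ⟨p, hp, q, hq, rfl, hqs, hpq⟩, hmax⟩ := hswap.exists_least (Set.toFinite _) hsrc hD
    have hgr : ∀ x ∈ L, ∀ y ∈ M, x.start = y.start → F.srcLt p.start x.start → x = y := by
      intro x hx y hy hxy h
      by_contra hne'
      have hxD : x.start ∈ D := ⟨x, hx, y, hy, rfl, hxy.symm, hne'⟩
      rcases hmax _ hxD with h' | h'
      · exact hF.src.irrefl _ (hsrc hxD) (by rwa [h'] at h)
      · exact hF.src.asymm (hsrc ⟨p, hp, q, hq, rfl, hqs, hpq⟩) (hsrc hxD) h h'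
    rcases (hF.totalOrderOn_postLt hG p.start).total _ (p.edges_mem_pathsFrom hG) q.edges
      (hqs ▸ q.edges_mem_pathsFrom hG) (fun h => hpq (DirGraph.Route.ext_edges hqs.symm h))
      with h | h
    · exact Or.inl ⟨p, hp, q, hq, hqs.symm, h, hgr⟩
    · exact Or.inr ⟨q, hq, p, hp, hqs, h,
        fun x hx y hy hxy h' => (hgr y hy x hx hxy.symm (by rwa [← hxy, ← hqs])).symm⟩

end LayeringOrder

/-! ### Layerings in the support of route weights. -/

section ExistsLayering

variable {V E : Type*} {G : DirGraph V E} {b : V → ℤ} {F : FramingData V E}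

/-- Weights on routes whose marginals are a positive multiple of the netflow vector contain a
layering in their support, by Hall's marriage theorem. -/
theorem exists_layering_of_marginals [Fintype V] [Fintype G.Route] (hb : IsUnitSupply G b)
    {c : G.Route → ℝ} {t : ℝ} (ht : 0 < t) (hc : ∀ P, 0 ≤ c P)
    (hstart : ∀ s, G.IsSource s → ∑ P : G.Route with P.start = s, c P = t * b s)
    (hfinish : ∀ v, G.IsSink v → ∑ P : G.Route with P.finish = v, c P = t * -b v) :
    ∃ L, IsLayering G b L ∧ ∀ P ∈ L, 0 < c P := by
  let S := {s : V // G.IsSource s ∧ b s = 1}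
  let d : V → ℕ := fun v => if G.IsSink v then (b v).natAbs else 0
  have hd : ∀ v, ∑ P : G.Route with P.finish = v, c P = t * (d v : ℝ) := by
    intro v
    by_cases hv : G.IsSink v
    · rw [hfinish v hv]
      have : ((b v).natAbs : ℤ) = -b v := Int.ofNat_natAbs_of_nonpos (hb.sink v hv)
      have h2 : ((b v).natAbs : ℝ) = -b v := by
        rw [← Int.cast_natCast, this, Int.cast_neg]
      simp only [d, if_pos hv, h2]
    · simp only [d, if_neg hv, Nat.cast_zero, mul_zero]
      refine Finset.sum_eq_zero fun P hP => absurd ?_ hv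
      obtain rfl : P.finish = v := by simpa using hP
      exact P.finish_isSink
  have hS : ∀ s : S, ∑ P : G.Route with P.start = s.1, c P = t := by
    intro s
    rw [hstart s s.2.1, s.2.2]
    simp
  have hS0 : ∀ P : G.Route, b P.start ≠ 1 → c P = 0 := by
    intro P hP
    have h0 := (hb.source _ P.start_isSource).resolve_right hP
    have := hstart _ P.start_isSource
    rw [h0, Int.cast_zero, mul_zero, Finset.sum_eq_zero_iff_of_nonneg fun Q _ => hc Q] at this
    exact this P (by simp)
  -- Each sink is split into as many slots as routes must end there; a perfect matching of sources
  -- with slots is then a layering.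
  let T := Σ v : V, Fin (d v)
  let R : S → T → Prop := fun s x => ∃ P : G.Route, P.start = s ∧ P.finish = x.1 ∧ 0 < c P
  -- Hall's condition by counting mass: all mass starting in `A` ends at sinks reached from `A` by
  -- routes of positive weight.
  have hall : ∀ A : Finset S, A.card ≤ (Finset.univ.filter fun x : T => ∃ s ∈ A, R s x).card := by
    intro A
    let TA : Finset V := Finset.univ.filter fun v =>
      ∃ s ∈ A, ∃ P : G.Route, P.start = s.1 ∧ P.finish = v ∧ 0 < c P
    have hcard : (Finset.univ.filter fun x : T => ∃ s ∈ A, R s x).card = ∑ v ∈ TA, d v := by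
      have : (Finset.univ.filter fun x : T => ∃ s ∈ A, R s x) =
          TA.sigma fun v => (Finset.univ : Finset (Fin (d v))) := by
        ext ⟨v, k⟩
        rw [Finset.mem_sigma]
        simp [TA, R]
      rw [this, Finset.card_sigma]
      simp
    rw [hcard, ← Nat.cast_le (α := ℝ), ← mul_le_mul_iff_right₀ ht]
    calc t * (A.card : ℝ) = ∑ s ∈ A, ∑ P : G.Route with P.start = s.1, c P := by
          rw [Finset.sum_congr rfl fun s _ => hS s, Finset.sum_const, nsmul_eq_mul, mul_comm]
      _ = ∑ P : G.Route, ∑ s ∈ A, if P.start = s.1 then c P else 0 := by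
          simp_rw [Finset.sum_filter]
          rw [Finset.sum_comm]
      _ ≤ ∑ P : G.Route, ∑ v ∈ TA, if P.finish = v then c P else 0 := by
          refine Finset.sum_le_sum fun P _ => ?_
          rw [Finset.sum_ite_eq]
          by_cases hP : ∃ s ∈ A, P.start = s.1
          · obtain ⟨s, hs, hPs⟩ := hP
            rw [Finset.sum_eq_single s (fun s' _ hne => if_neg fun h =>
              hne (Subtype.ext (h.symm.trans hPs))) (fun h => absurd hs h), if_pos hPs]
            split_ifs with h
            · exact le_rfl
            · refine not_lt.1 fun hpos => h ?_
              simp only [TA, Finset.mem_filter, Finset.mem_univ, true_and]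
              exact ⟨s, hs, P, hPs, rfl, hpos⟩
          · push Not at hP
            rw [Finset.sum_eq_zero fun s hs => if_neg (hP s hs)]
            split_ifs
            · exact hc P
            · exact le_rfl
      _ = t * ((∑ v ∈ TA, d v : ℕ) : ℝ) := by
          rw [Finset.sum_comm]
          simp_rw [← Finset.sum_filter]
          rw [Finset.sum_congr rfl fun v _ => hd v, ← Finset.mul_sum]
          push_cast
          rfl
  obtain ⟨f, hf, hfR⟩ := (Fintype.all_card_le_filter_rel_iff_exists_injective R).1 hall
  have hcardeq : Fintype.card S = Fintype.card T := by
    have h1 : t * (Fintype.card S : ℝ) = ∑ P : G.Route, c P := by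
      calc t * (Fintype.card S : ℝ) = ∑ s : S, ∑ P : G.Route with P.start = s.1, c P := by
            rw [Finset.sum_congr rfl fun s _ => hS s, Finset.sum_const, nsmul_eq_mul, mul_comm]
            rfl
        _ = ∑ P : G.Route, ∑ s : S, if P.start = s.1 then c P else 0 := by
            simp_rw [Finset.sum_filter]
            rw [Finset.sum_comm]
        _ = _ := by
            refine Finset.sum_congr rfl fun P _ => ?_
            by_cases hP : b P.start = 1
            · rw [Finset.sum_eq_single ⟨P.start, P.start_isSource, hP⟩]
              · simp
              · intro s _ hne
                rw [if_neg]
                exact fun h => hne (Subtype.ext h.symm)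
              · simp
            · rw [hS0 P hP]
              simp
    have h2 : t * (Fintype.card T : ℝ) = ∑ P : G.Route, c P := by
      rw [← Finset.sum_fiberwise Finset.univ (fun P : G.Route => P.finish) c,
        Finset.sum_congr rfl fun v _ => hd v, ← Finset.mul_sum, Fintype.card_sigma]
      simp
    have := h1.trans h2.symm
    exact_mod_cast mul_left_cancel₀ ht.ne' this
  have hfb := (Fintype.bijective_iff_injective_and_card f).2 ⟨hf, hcardeq⟩
  choose P hPs hPf hPc using hfR
  have hPinj : Function.Injective P := by
    intro s s' h
    apply Subtype.ext
    rw [← hPs s, ← hPs s', h]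
  have hcount : ∀ φ : G.Route → Prop, ((Finset.univ.image P).filter φ).card =
      (Finset.univ.filter fun s => φ (P s)).card := by
    intro φ
    rw [Finset.filter_image, Finset.card_image_of_injective _ hPinj]
  refine ⟨Finset.univ.image P, ⟨?_, ?_⟩, ?_⟩
  · intro i hi
    rw [hcount]
    simp_rw [hPs]
    rcases hb.source i hi with h | h
    · rw [h, Nat.cast_eq_zero, Finset.card_eq_zero, Finset.filter_eq_empty_iff]
      intro s _ hs
      have := s.2.2
      rw [hs, h] at this
      exact zero_ne_one this
    · rw [h]
      have : (Finset.univ.filter fun s : S => s.1 = i) = {⟨i, hi, h⟩} := by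
        ext s
        rw [Finset.mem_filter, Finset.mem_singleton]
        exact ⟨fun h' => Subtype.ext h'.2, fun h' => ⟨Finset.mem_univ _, congrArg Subtype.val h'⟩⟩
      rw [this]
      simp
  · intro j hj
    rw [hcount]
    simp_rw [hPf]
    have h1 : (Finset.univ.filter fun s => (f s).1 = j).card =
        (Finset.univ.filter fun x : T => x.1 = j).card :=
      Finset.card_bijective f hfb (by simp)
    have h2 : (Finset.univ.filter fun x : T => x.1 = j) =
        ({j} : Finset V).sigma fun v => (Finset.univ : Finset (Fin (d v))) := by
      ext ⟨v, k⟩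
      rw [Finset.mem_sigma]
      simp
    rw [h1, h2, Finset.card_sigma]
    simp [d, hj]
  · intro Q hQ
    obtain ⟨s, -, rfl⟩ := Finset.mem_image.1 hQ
    exact hPc s

end ExistsLayering

/-! ### Route weights as combinations of layerings. -/

section LayerSum

variable {V E : Type*} {G : DirGraph V E} {b : V → ℤ} {F : FramingData V E}

/-- The weights on routes induced by weights on layerings. -/
noncomputable def layerSum (𝓛 : Finset (Finset G.Route)) (μ : Finset G.Route → ℝ)
    (P : G.Route) : ℝ := ∑ L ∈ 𝓛, if P ∈ L then μ L else 0

theorem layerSum_nonneg {𝓛 : Finset (Finset G.Route)} {μ : Finset G.Route → ℝ}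
    (hμ : ∀ L ∈ 𝓛, 0 < μ L) (P : G.Route) : 0 ≤ layerSum 𝓛 μ P :=
  Finset.sum_nonneg fun L hL => by
    split_ifs
    · exact (hμ L hL).le
    · exact le_rfl

theorem layerSum_pos_iff {𝓛 : Finset (Finset G.Route)} {μ : Finset G.Route → ℝ}
    (hμ : ∀ L ∈ 𝓛, 0 < μ L) {P : G.Route} : 0 < layerSum 𝓛 μ P ↔ ∃ L ∈ 𝓛, P ∈ L := by
  constructor
  · intro h
    obtain ⟨L, hL, hne⟩ := Finset.exists_ne_zero_of_sum_ne_zero h.ne'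
    refine ⟨L, hL, ?_⟩
    by_contra hP
    exact hne (if_neg hP)
  · rintro ⟨L, hL, hP⟩
    refine Finset.sum_pos' (fun M hM => ?_) ⟨L, hL, ?_⟩
    · split_ifs
      · exact (hμ M hM).le
      · exact le_rfl
    · rw [if_pos hP]
      exact hμ L hL

theorem layerSum_erase {𝓛 : Finset (Finset G.Route)} (μ : Finset G.Route → ℝ)
    {L : Finset G.Route} (hL : L ∈ 𝓛) (P : G.Route) :
    layerSum 𝓛 μ P = (if P ∈ L then μ L else 0) + layerSum (𝓛.erase L) μ P :=
  (Finset.add_sum_erase 𝓛 _ hL).symm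

theorem sum_mul_layerSum [Fintype G.Route] (𝓛 : Finset (Finset G.Route))
    (μ : Finset G.Route → ℝ) (φ : G.Route → ℝ) :
    ∑ P, layerSum 𝓛 μ P * φ P = ∑ L ∈ 𝓛, μ L * ∑ P ∈ L, φ P := by
  simp_rw [layerSum, Finset.sum_mul]
  rw [Finset.sum_comm]
  refine Finset.sum_congr rfl fun L _ => ?_
  simp_rw [ite_mul, zero_mul]
  rw [← Finset.sum_filter, Finset.mul_sum]
  simp

theorem sum_filter_layerSum [Fintype G.Route] (𝓛 : Finset (Finset G.Route))
    (μ : Finset G.Route → ℝ) (φ : G.Route → Prop) :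
    ∑ P with φ P, layerSum 𝓛 μ P = ∑ L ∈ 𝓛, μ L * ((L.filter φ).card : ℝ) := by
  have := sum_mul_layerSum 𝓛 μ (fun P => if φ P then 1 else 0)
  simpa [Finset.sum_filter] using this

/-- Removing layerings only shrinks the sets of routes in conditions 1, 2 and 3. -/
theorem IsLayeringSimplex.subset {𝓛 𝓜 : Finset (Finset G.Route)}
    (h : IsLayeringSimplex G b F 𝓛) (hs : 𝓜 ⊆ 𝓛) : IsLayeringSimplex G b F 𝓜 where
  layering := fun L hL => h.layering L (hs hL)
  clique := by
    rintro p ⟨L, hL, hp⟩ q ⟨M, hM, hq⟩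
    exact h.clique p ⟨L, hs hL, hp⟩ q ⟨M, hs hM, hq⟩
  least := by
    intro L hL M hM hr
    refine h.least L (hs hL) M hM fun p hp => ?_
    obtain ⟨K, hK, hpK⟩ := hr p hp
    exact ⟨K, ⟨hs hK.1, hK.2⟩, hpK⟩
  newRoute := by
    intro L hL
    obtain ⟨p, hp, hn⟩ := h.newRoute L (hs hL)
    refine ⟨p, hp, ?_⟩
    rintro ⟨K, hK, hpK⟩
    exact hn ⟨K, ⟨hs hK.1, hK.2⟩, hpK⟩

theorem isLayeringSimplex_empty : IsLayeringSimplex G b F ∅ where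
  layering := by simp
  clique := by
    rintro p ⟨L, hL, -⟩
    simp at hL
  least := by simp
  newRoute := by simp

theorem IsLayeringSimplex.exists_least {𝓛 : Finset (Finset G.Route)}
    (hO : TotalOrderOn F.LayeringLt {L | IsLayering G b L}) (h : IsLayeringSimplex G b F 𝓛)
    (hne : 𝓛.Nonempty) : ∃ L ∈ 𝓛, ∀ K ∈ 𝓛, K = L ∨ F.LayeringLt L K := by
  obtain ⟨L, hL, hmin⟩ := (hO.mono (t := (𝓛 : Set (Finset G.Route))) h.layering).exists_least
    (Finset.finite_toSet _) subset_rfl hne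
  exact ⟨L, hL, fun K hK => (hmin K hK).imp Eq.symm id⟩

/-- Shows that the least member can be read off from the support of the route weights. -/
theorem IsLayeringSimplex.least_of_support {𝓛 : Finset (Finset G.Route)}
    (h : IsLayeringSimplex G b F 𝓛) {μ : Finset G.Route → ℝ} (hμ : ∀ L ∈ 𝓛, 0 < μ L)
    {L : Finset G.Route} (hL : L ∈ 𝓛) (hmin : ∀ K ∈ 𝓛, K = L ∨ F.LayeringLt L K)
    {M : Finset G.Route} (hM : IsLayering G b M) (hMs : ∀ p ∈ M, 0 < layerSum 𝓛 μ p) :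
    L = M ∨ F.LayeringLt L M := by
  refine h.least L hL M hM fun p hp => ?_
  obtain ⟨K, hK, hpK⟩ := (layerSum_pos_iff hμ).1 (hMs p hp)
  exact ⟨K, ⟨hK, hmin K hK⟩, hpK⟩

/-- The route that condition 3 provides for the least member occurs in no other member. With
`le_layerSum`, the coefficient of `L` is the least weight on its routes. -/
theorem IsLayeringSimplex.exists_layerSum_eq {𝓛 : Finset (Finset G.Route)}
    (h : IsLayeringSimplex G b F 𝓛) (μ : Finset G.Route → ℝ)
    {L : Finset G.Route} (hL : L ∈ 𝓛) (hmin : ∀ K ∈ 𝓛, K = L ∨ F.LayeringLt L K) :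
    ∃ p ∈ L, layerSum 𝓛 μ p = μ L := by
  obtain ⟨p, hp, hn⟩ := h.newRoute L hL
  refine ⟨p, hp, ?_⟩
  rw [layerSum_erase μ hL, if_pos hp, layerSum, Finset.sum_eq_zero, add_zero]
  intro K hK
  rw [Finset.mem_erase] at hK
  exact if_neg fun hpK => hn ⟨K, ⟨hK.2, (hmin K hK.2).resolve_left hK.1⟩, hpK⟩

theorem le_layerSum {𝓛 : Finset (Finset G.Route)} {μ : Finset G.Route → ℝ}
    (hμ : ∀ L ∈ 𝓛, 0 < μ L) {L : Finset G.Route} (hL : L ∈ 𝓛) {p : G.Route} (hp : p ∈ L) :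
    μ L ≤ layerSum 𝓛 μ p := by
  rw [layerSum_erase μ hL, if_pos hp, le_add_iff_nonneg_right]
  exact layerSum_nonneg (fun K hK => hμ K (Finset.mem_of_mem_erase hK)) p

/-- The route weights determine the least member and its coefficient; removing it on both sides
leaves smaller simplices with equal weights. -/
theorem layerSum_unique (hO : TotalOrderOn F.LayeringLt {L | IsLayering G b L}) (n : ℕ) :
    ∀ {𝓛 𝓜 : Finset (Finset G.Route)} {μ ν : Finset G.Route → ℝ}, 𝓛.card = n →
      IsLayeringSimplex G b F 𝓛 → IsLayeringSimplex G b F 𝓜 → (∀ L ∈ 𝓛, 0 < μ L) →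
      (∀ L ∈ 𝓜, 0 < ν L) → layerSum 𝓛 μ = layerSum 𝓜 ν → 𝓛 = 𝓜 ∧ ∀ L ∈ 𝓛, μ L = ν L := by
  induction n with
  | zero =>
    intro 𝓛 𝓜 μ ν hn h𝓛 h𝓜 hμ hν heq
    obtain rfl := Finset.card_eq_zero.1 hn
    refine ⟨?_, by simp⟩
    rcases 𝓜.eq_empty_or_nonempty with rfl | ⟨M, hM⟩
    · rfl
    · obtain ⟨p, hp, -⟩ := h𝓜.newRoute M hM
      have := (layerSum_pos_iff hν).2 ⟨M, hM, hp⟩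
      rw [← heq] at this
      simp [layerSum] at this
  | succ n ih =>
    intro 𝓛 𝓜 μ ν hn h𝓛 h𝓜 hμ hν heq
    have hne : 𝓛.Nonempty := Finset.card_pos.1 (by omega)
    obtain ⟨L, hL, hmin⟩ := h𝓛.exists_least hO hne
    have hne' : 𝓜.Nonempty := by
      obtain ⟨p, hp, -⟩ := h𝓛.newRoute L hL
      have := (layerSum_pos_iff hμ).2 ⟨L, hL, hp⟩
      rw [heq, layerSum_pos_iff hν] at this
      obtain ⟨M, hM, -⟩ := this
      exact ⟨M, hM⟩
    obtain ⟨M, hM, hmin'⟩ := h𝓜.exists_least hO hne'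
    have hLM : L = M := by
      have h1 := h𝓛.least_of_support hμ hL hmin (h𝓜.layering M hM) fun p hp => by
        rw [heq]
        exact (layerSum_pos_iff hν).2 ⟨M, hM, hp⟩
      have h2 := h𝓜.least_of_support hν hM hmin' (h𝓛.layering L hL) fun p hp => by
        rw [← heq]
        exact (layerSum_pos_iff hμ).2 ⟨L, hL, hp⟩
      rcases h1 with h1 | h1
      · exact h1
      · rcases h2 with h2 | h2
        · exact h2.symm
        · exact absurd h2 (hO.asymm (h𝓛.layering L hL) (h𝓜.layering M hM) h1)
    subst hLM
    have hval : μ L = ν L := by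
      obtain ⟨p, hp, hpe⟩ := h𝓛.exists_layerSum_eq μ hL hmin
      obtain ⟨q, hq, hqe⟩ := h𝓜.exists_layerSum_eq ν hM hmin'
      apply le_antisymm
      · rw [← hqe, ← heq]
        exact le_layerSum hμ hL hq
      · rw [← hpe, heq]
        exact le_layerSum hν hM hp
    obtain ⟨h1, h2⟩ := ih (𝓛 := 𝓛.erase L) (𝓜 := 𝓜.erase L) (μ := μ) (ν := ν)
      (by rw [Finset.card_erase_of_mem hL]; omega) (h𝓛.subset (Finset.erase_subset _ _))
      (h𝓜.subset (Finset.erase_subset _ _)) (fun K hK => hμ K (Finset.mem_of_mem_erase hK))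
      (fun K hK => hν K (Finset.mem_of_mem_erase hK)) (by
        funext p
        have := congrFun heq p
        rw [layerSum_erase μ hL, layerSum_erase ν hM, hval] at this
        exact add_left_cancel this)
    refine ⟨?_, fun K hK => ?_⟩
    · rw [← Finset.insert_erase hL, h1, Finset.insert_erase hM]
    · by_cases hKL : K = L
      · rw [hKL, hval]
      · exact h2 K (Finset.mem_erase.2 ⟨hKL, hK⟩)

/-- The greedy procedure: each subtraction removes a route from the support and lowers the scale `t`
of the margins by the coefficient, so the induction is on the size of the support. -/
theorem exists_layerSum_eq [Fintype V] [Fintype G.Route] (hb : IsUnitSupply G b)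
    (hO : TotalOrderOn F.LayeringLt {L | IsLayering G b L}) (n : ℕ) :
    ∀ (c : G.Route → ℝ) (t : ℝ), (Finset.univ.filter fun P => 0 < c P).card = n →
      (∀ P, 0 ≤ c P) → F.IsRouteClique {P | 0 < c P} →
      (∀ s, G.IsSource s → ∑ P : G.Route with P.start = s, c P = t * b s) →
      (∀ v, G.IsSink v → ∑ P : G.Route with P.finish = v, c P = t * -b v) →
      ∃ 𝓛 μ, IsLayeringSimplex G b F 𝓛 ∧ (∀ L ∈ 𝓛, 0 < μ L) ∧ layerSum 𝓛 μ = c := by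
  induction n using Nat.strong_induction_on with
  | _ n ih =>
    intro c t hn hc hclique hstart hfinish
    rcases (Finset.univ.filter fun P => 0 < c P).eq_empty_or_nonempty with hemp | ⟨P, hP⟩
    · refine ⟨∅, 0, isLayeringSimplex_empty, by simp, ?_⟩
      funext P
      have := (Finset.filter_eq_empty_iff.1 hemp) (Finset.mem_univ P)
      rw [le_antisymm (not_lt.1 this) (hc P)]
      simp [layerSum]
    simp only [Finset.mem_filter, Finset.mem_univ, true_and] at hP
    have hpos : 0 < t * (b P.start : ℝ) := by
      rw [← hstart _ P.start_isSource]
      exact Finset.sum_pos' (fun Q _ => hc Q) ⟨P, by simp, hP⟩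
    have hb1 : b P.start = 1 := by
      rcases hb.source _ P.start_isSource with h | h
      · rw [h] at hpos
        simp at hpos
      · exact h
    have ht : 0 < t := by
      rw [hb1] at hpos
      simpa using hpos
    obtain ⟨L₀, hL₀⟩ := exists_layering_of_marginals hb ht hc hstart hfinish
    obtain ⟨L, ⟨hL, hLc⟩, hmin⟩ := hO.exists_least (Set.toFinite _)
      (t := {L | IsLayering G b L ∧ ∀ P ∈ L, 0 < c P}) (fun _ h => h.1) ⟨L₀, hL₀⟩
    obtain ⟨p, ⟨hpL, -⟩, -⟩ := hL.existsUnique_route P.start_isSource hb1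
    obtain ⟨p₀, hp₀, hp₀min⟩ := Finset.exists_min_image L c ⟨p, hpL⟩
    have hε := hLc p₀ hp₀
    let c' : G.Route → ℝ := fun Q => c Q - if Q ∈ L then c p₀ else 0
    have hc' : ∀ Q, 0 ≤ c' Q := by
      intro Q
      simp only [c']
      split_ifs with h
      · exact sub_nonneg.2 (hp₀min Q h)
      · simpa using hc Q
    have hc'c : ∀ Q, 0 < c' Q → 0 < c Q := by
      intro Q hQ
      refine lt_of_lt_of_le hQ ?_
      simp only [c']
      split_ifs <;> linarith
    have hc'p₀ : c' p₀ = 0 := by simp [c', hp₀]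
    have hsum : ∀ φ : G.Route → Prop, ∑ Q with φ Q, c' Q =
        ∑ Q with φ Q, c Q - c p₀ * ((L.filter φ).card : ℝ) := by
      intro φ
      simp only [c', Finset.sum_sub_distrib]
      congr 1
      have := sum_filter_layerSum {L} (fun _ => c p₀) φ
      simpa [layerSum] using this
    obtain ⟨𝓛, μ, h𝓛, hμ, hsumμ⟩ := ih _ (by
        rw [← hn]
        apply Finset.card_lt_card
        rw [Finset.ssubset_iff_of_subset]
        · exact ⟨p₀, by simp [hε], by simp [hc'p₀]⟩
        · intro Q hQ
          simp only [Finset.mem_filter, Finset.mem_univ, true_and] at hQ ⊢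
          exact hc'c Q hQ) c' (t - c p₀) rfl hc'
      (fun x hx y hy => hclique x (hc'c x hx) y (hc'c y hy))
      (fun s hs => by
        rw [hsum, hstart s hs]
        have : ((L.filter fun P => P.start = s).card : ℝ) = b s := by
          exact_mod_cast hL.source s hs
        rw [this]
        ring)
      (fun v hv => by
        rw [hsum, hfinish v hv]
        have h1 := hL.sink v hv
        rw [abs_of_nonpos (hb.sink v hv)] at h1
        have : ((L.filter fun P => P.finish = v).card : ℝ) = -b v := by
          exact_mod_cast h1
        rw [this]
        ring)
    have hroute : ∀ K ∈ 𝓛, ∀ Q ∈ K, 0 < c' Q := by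
      intro K hK Q hQ
      rw [← hsumμ]
      exact (layerSum_pos_iff hμ).2 ⟨K, hK, hQ⟩
    have hLn : L ∉ 𝓛 := fun h => (hroute L h p₀ hp₀).ne' hc'p₀
    -- Later layerings are supported where `c` is positive and avoid `p₀`, so minimality of `L` puts
    -- them strictly above it.
    have hlt : ∀ K ∈ 𝓛, F.LayeringLt L K := by
      intro K hK
      refine (hmin K ⟨h𝓛.layering K hK, fun Q hQ => hc'c Q (hroute K hK Q hQ)⟩).resolve_left ?_
      rintro rfl
      exact hLn hK
    have hins : ∀ K ∈ insert L 𝓛, ∀ Q ∈ K, 0 < c Q := by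
      intro K hK Q hQ
      rcases Finset.mem_insert.1 hK with rfl | hK
      · exact hLc Q hQ
      · exact hc'c Q (hroute K hK Q hQ)
    refine ⟨insert L 𝓛, fun K => if K = L then c p₀ else μ K, ⟨?_, ?_, ?_, ?_⟩, ?_, ?_⟩
    · intro K hK
      rcases Finset.mem_insert.1 hK with rfl | hK
      · exact hL
      · exact h𝓛.layering K hK
    · rintro x ⟨K, hK, hx⟩ y ⟨M, hM, hy⟩
      exact hclique x (hins K hK x hx) y (hins M hM y hy)
    · intro K hK M hM hMr
      rcases Finset.mem_insert.1 hK with rfl | hK'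
      · refine hmin M ⟨hM, fun Q hQ => ?_⟩
        obtain ⟨N, hN, hQN⟩ := hMr Q hQ
        exact hins N hN.1 Q hQN
      · refine h𝓛.least K hK' M hM fun Q hQ => ?_
        obtain ⟨N, ⟨hN, hKN⟩, hQN⟩ := hMr Q hQ
        rcases Finset.mem_insert.1 hN with rfl | hN
        · exfalso
          rcases hKN with rfl | hKN
          · exact hLn hK'
          · exact hO.asymm (h𝓛.layering K hK') hL hKN (hlt K hK')
        · exact ⟨N, ⟨hN, hKN⟩, hQN⟩
    · intro K hK
      rcases Finset.mem_insert.1 hK with rfl | hK'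
      · refine ⟨p₀, hp₀, ?_⟩
        rintro ⟨N, ⟨hN, hKN⟩, hQN⟩
        rcases Finset.mem_insert.1 hN with rfl | hN
        · exact hO.irrefl _ hL hKN
        · exact (hroute N hN p₀ hQN).ne' hc'p₀
      · obtain ⟨Q, hQ, hQn⟩ := h𝓛.newRoute K hK'
        refine ⟨Q, hQ, ?_⟩
        rintro ⟨N, ⟨hN, hKN⟩, hQN⟩
        rcases Finset.mem_insert.1 hN with rfl | hN
        · exact hO.asymm (h𝓛.layering K hK') hL hKN (hlt K hK')
        · exact hQn ⟨N, ⟨hN, hKN⟩, hQN⟩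
    · intro K hK
      dsimp only
      split_ifs with h
      · exact hε
      · exact hμ K ((Finset.mem_insert.1 hK).resolve_left h)
    · funext Q
      rw [layerSum, Finset.sum_insert hLn]
      have : ∑ K ∈ 𝓛, (if Q ∈ K then (if K = L then c p₀ else μ K) else 0) = layerSum 𝓛 μ Q := by
        refine Finset.sum_congr rfl fun K hK => ?_
        rw [if_neg (c := K = L)]
        rintro rfl
        exact hLn hK
      rw [this, hsumμ]
      simp [c']

end LayerSum

/-! ### Layering-simplices in the flow polytope and their dimension. -/

section Purity

variable {V E : Type*} {G : DirGraph V E} {b : V → ℤ} {F : FramingData V E}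

theorem DirGraph.IsPath.netflow_count [Fintype E] {u v : V} {p : List E} (h : G.IsPath u p v)
    (i : V) : ∑ e with G.tail e = i, (p.count e : ℝ) - ∑ e with G.head e = i, (p.count e : ℝ) =
      (if u = i then 1 else 0) - (if v = i then 1 else 0) := by
  induction p generalizing u with
  | nil =>
    obtain rfl : u = v := h
    simp
  | cons e p ih =>
    obtain ⟨rfl, h⟩ := h
    have := ih h
    simp_rw [List.count_cons, Nat.cast_add, Finset.sum_add_distrib]
    have key : ∀ k : E → V, ∑ g with k g = i, (((if (e == g) = true then 1 else 0 : ℕ)) : ℝ) =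
        if k e = i then 1 else 0 := by
      intro k
      simp
    rw [key, key]
    linarith

/-- The flow of a set of routes. -/
noncomputable def routesFlow (L : Finset G.Route) : E → ℝ :=
  fun e => ∑ P ∈ L, (P.edges.count e : ℝ)

theorem IsLayering.routesFlow_mem [Fintype E] (hb : IsUnitSupply G b) {L : Finset G.Route}
    (hL : IsLayering G b L) : routesFlow L ∈ G.flowPolytope b := by
  refine ⟨fun e => Finset.sum_nonneg fun P _ => Nat.cast_nonneg _, fun i => ?_⟩
  have h1 : ∑ e with G.tail e = i, routesFlow L e - ∑ e with G.head e = i, routesFlow L e =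
      ((L.filter fun P => P.start = i).card : ℝ) - ((L.filter fun P => P.finish = i).card : ℝ) := by
    unfold routesFlow
    rw [Finset.sum_comm, Finset.sum_comm (t := L), ← Finset.sum_sub_distrib,
      Finset.sum_congr rfl fun P _ => P.isPath.netflow_count i, Finset.sum_sub_distrib]
    simp
  rw [h1]
  by_cases hs : G.IsSource i <;> by_cases ht : G.IsSink i
  · have h0 : b i = 0 := by
      have := hb.sink i ht
      rcases hb.source i hs with h | h <;> omega
    have e1 := hL.source i hs
    have e2 := hL.sink i ht
    rw [h0] at e1 e2 ⊢
    have e1' : ((L.filter fun P => P.start = i).card : ℝ) = 0 := by exact_mod_cast e1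
    have e2' : ((L.filter fun P => P.finish = i).card : ℝ) = 0 := by exact_mod_cast e2
    rw [e1', e2']
    simp
  · have e1 : ((L.filter fun P => P.start = i).card : ℝ) = b i := by
      exact_mod_cast hL.source i hs
    have e2 : (L.filter fun P => P.finish = i) = ∅ :=
      Finset.filter_eq_empty_iff.2 fun P _ h => ht (h ▸ P.finish_isSink)
    rw [e1, e2]
    simp
  · have e1 := hL.sink i ht
    rw [abs_of_nonpos (hb.sink i ht)] at e1
    have e1' : ((L.filter fun P => P.finish = i).card : ℝ) = -b i := by exact_mod_cast e1
    have e2 : (L.filter fun P => P.start = i) = ∅ :=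
      Finset.filter_eq_empty_iff.2 fun P _ h => hs (h ▸ P.start_isSource)
    rw [e1', e2]
    simp
  · have e1 : (L.filter fun P => P.finish = i) = ∅ :=
      Finset.filter_eq_empty_iff.2 fun P _ h => ht (h ▸ P.finish_isSink)
    have e2 : (L.filter fun P => P.start = i) = ∅ :=
      Finset.filter_eq_empty_iff.2 fun P _ h => hs (h ▸ P.start_isSource)
    rw [e1, e2, hb.internal i ⟨hs, ht⟩]
    simp

theorem sum_layerSum_mul_count [Fintype G.Route] (𝓛 : Finset (Finset G.Route))
    (μ : Finset G.Route → ℝ) (e : E) :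
    ∑ P, layerSum 𝓛 μ P * (P.edges.count e : ℝ) = (∑ L ∈ 𝓛, μ L • routesFlow L) e := by
  rw [sum_mul_layerSum]
  simp [routesFlow]

theorem IsLayeringSimplex.isCliqueDecomposition [Fintype G.Route] (hb : IsUnitSupply G b)
    {𝓛 : Finset (Finset G.Route)} (h : IsLayeringSimplex G b F 𝓛) {μ : Finset G.Route → ℝ}
    (hμ : ∀ L ∈ 𝓛, 0 < μ L) (hμ1 : ∑ L ∈ 𝓛, μ L = 1) :
    IsCliqueDecomposition b F (∑ L ∈ 𝓛, μ L • routesFlow L) (layerSum 𝓛 μ) where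
  nonneg := layerSum_nonneg hμ
  clique := fun P hP Q hQ => h.clique P ((layerSum_pos_iff hμ).1 hP) Q ((layerSum_pos_iff hμ).1 hQ)
  edge := sum_layerSum_mul_count 𝓛 μ
  start := by
    intro s hs
    rw [sum_filter_layerSum]
    have : ∀ L ∈ 𝓛, μ L * ((L.filter fun P => P.start = s).card : ℝ) = μ L * b s := by
      intro L hL
      have : ((L.filter fun P => P.start = s).card : ℝ) = b s := by
        exact_mod_cast (h.layering L hL).source s hs
      rw [this]
    rw [Finset.sum_congr rfl this, ← Finset.sum_mul, hμ1, one_mul]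
  finish := by
    intro t ht
    rw [sum_filter_layerSum]
    have : ∀ L ∈ 𝓛, μ L * ((L.filter fun P => P.finish = t).card : ℝ) = μ L * -b t := by
      intro L hL
      have h1 := (h.layering L hL).sink t ht
      rw [abs_of_nonpos (hb.sink t ht)] at h1
      have : ((L.filter fun P => P.finish = t).card : ℝ) = -b t := by exact_mod_cast h1
      rw [this]
    rw [Finset.sum_congr rfl this, ← Finset.sum_mul, hμ1, one_mul]

/-- Points of the flow polytope have at most one expression as a convex combination with positive
coefficients of the flows of a layering-simplex. -/
theorem IsLayeringSimplex.convexCombination_unique [Finite V] [Fintype E] (hG : G.Acyclic)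
    (hb : IsUnitSupply G b) (hF : IsFramed G b F) {𝓛 𝓜 : Finset (Finset G.Route)}
    (h : IsLayeringSimplex G b F 𝓛) (h' : IsLayeringSimplex G b F 𝓜) {μ ν : Finset G.Route → ℝ}
    (hμ : ∀ L ∈ 𝓛, 0 < μ L) (hμ1 : ∑ L ∈ 𝓛, μ L = 1) (hν : ∀ L ∈ 𝓜, 0 < ν L)
    (hν1 : ∑ L ∈ 𝓜, ν L = 1)
    (heq : ∑ L ∈ 𝓛, μ L • routesFlow L = ∑ L ∈ 𝓜, ν L • routesFlow L) :
    𝓛 = 𝓜 ∧ ∀ L ∈ 𝓛, μ L = ν L := by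
  have := DirGraph.Route.finite hG
  have := Fintype.ofFinite G.Route
  refine layerSum_unique (hF.totalOrderOn_layeringLt hG hb) _ rfl h h' hμ hν ?_
  have h1 := h.isCliqueDecomposition hb hμ hμ1
  rw [heq] at h1
  exact h1.unique hG hF (h'.isCliqueDecomposition hb hν hν1)

/-- Every point of the flow polytope lies in the relative interior of a layering-simplex. -/
theorem exists_convexCombination [Fintype V] [Fintype E] (hG : G.Acyclic)
    (hb : IsUnitSupply G b) (hF : IsFramed G b F) (hb0 : b ≠ 0) {f : E → ℝ}
    (hf : f ∈ G.flowPolytope b) :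
    ∃ (𝓛 : Finset (Finset G.Route)) (μ : Finset G.Route → ℝ),
      IsLayeringSimplex G b F 𝓛 ∧ (∀ L ∈ 𝓛, 0 < μ L) ∧ ∑ L ∈ 𝓛, μ L = 1 ∧
      ∑ L ∈ 𝓛, μ L • routesFlow L = f := by
  have := DirGraph.Route.finite hG
  have := Fintype.ofFinite G.Route
  obtain ⟨c, hc⟩ := exists_isCliqueDecomposition hG hb hF hf
  obtain ⟨𝓛, μ, h𝓛, hμ, hsum⟩ := exists_layerSum_eq hb (hF.totalOrderOn_layeringLt hG hb) _ c 1 rfl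
    hc.nonneg hc.clique (fun s hs => by rw [hc.start s hs, one_mul])
    (fun t ht => by rw [hc.finish t ht, one_mul])
  refine ⟨𝓛, μ, h𝓛, hμ, ?_, ?_⟩
  -- Every layering has one route from a source `s` of supply 1, so the coefficients sum to the mass
  -- starting at `s`. Without such a source the flow, and hence `b`, would be zero.
  · obtain ⟨s, hs, hbs⟩ : ∃ s, G.IsSource s ∧ b s = 1 := by
      by_contra! hno
      have hc0 : ∀ P, c P = 0 := by
        intro P
        have h0 := (hb.source _ P.start_isSource).resolve_right (hno _ P.start_isSource)
        have := hc.start _ P.start_isSource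
        rw [h0, Int.cast_zero, Finset.sum_eq_zero_iff_of_nonneg fun Q _ => hc.nonneg Q] at this
        exact this P (by simp)
      have hf0 : ∀ e, f e = 0 := by
        intro e
        rw [← hc.edge e]
        simp [hc0]
      apply hb0
      funext i
      have := hf.2 i
      simp only [hf0, Finset.sum_const_zero, sub_zero] at this
      exact_mod_cast this.symm
    have h1 := hc.start s hs
    rw [← hsum, sum_filter_layerSum, hbs] at h1
    rw [← Int.cast_one, ← h1]
    refine Finset.sum_congr rfl fun L hL => ?_
    have : ((L.filter fun P => P.start = s).card : ℝ) = 1 := by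
      have := (h𝓛.layering L hL).source s hs
      rw [hbs] at this
      exact_mod_cast this
    rw [this, mul_one]
  · funext e
    rw [← sum_layerSum_mul_count, hsum, hc.edge]

/-- The convex hull of the flows of a family of sets of routes. -/
def flowHull (𝓛 : Finset (Finset G.Route)) : Set (E → ℝ) :=
  (fun μ : 𝓛 → ℝ => ∑ L, μ L • routesFlow L.1) '' stdSimplex ℝ 𝓛

theorem isClosed_flowHull (𝓛 : Finset (Finset G.Route)) : IsClosed (flowHull 𝓛) :=
  ((isCompact_stdSimplex ℝ 𝓛).image (by fun_prop)).isClosed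

theorem mem_flowHull {𝓛 : Finset (Finset G.Route)} {x : E → ℝ} :
    x ∈ flowHull 𝓛 ↔ ∃ μ : Finset G.Route → ℝ, (∀ L ∈ 𝓛, 0 ≤ μ L) ∧ ∑ L ∈ 𝓛, μ L = 1 ∧
      ∑ L ∈ 𝓛, μ L • routesFlow L = x := by
  constructor
  · rintro ⟨μ, ⟨h0, h1⟩, rfl⟩
    refine ⟨fun L => if h : L ∈ 𝓛 then μ ⟨L, h⟩ else 0, fun L hL => ?_, ?_, ?_⟩
    · simp only [dif_pos hL]
      exact h0 _
    · rw [← Finset.sum_attach, ← h1]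
      exact Finset.sum_congr rfl fun L _ => by simp
    · rw [← Finset.sum_attach]
      exact Finset.sum_congr rfl fun L _ => by simp
  · rintro ⟨μ, h0, h1, rfl⟩
    refine ⟨fun L => μ L.1, ⟨fun L => h0 _ L.2, ?_⟩, ?_⟩
    · rw [← h1]
      exact Finset.sum_attach 𝓛 μ
    · exact Finset.sum_attach 𝓛 fun L => μ L • routesFlow L

theorem sum_smul_routesFlow_mem_vectorSpan {𝓛 : Finset (Finset G.Route)}
    {w : Finset G.Route → ℝ} (hw : ∑ L ∈ 𝓛, w L = 0) :
    ∑ L ∈ 𝓛, w L • routesFlow L ∈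
      vectorSpan ℝ (Set.range fun L : 𝓛 => routesFlow (L : Finset G.Route)) := by
  rcases 𝓛.eq_empty_or_nonempty with rfl | ⟨L₀, hL₀⟩
  · simp
  · have : ∑ L ∈ 𝓛, w L • routesFlow L =
        ∑ L ∈ 𝓛, w L • (routesFlow L - routesFlow L₀) := by
      simp_rw [smul_sub]
      rw [Finset.sum_sub_distrib, ← Finset.sum_smul, hw, zero_smul, sub_zero]
    rw [this]
    exact Submodule.sum_mem _ fun L hL => Submodule.smul_mem _ _
      (vsub_mem_vectorSpan ℝ ⟨⟨L, hL⟩, rfl⟩ ⟨⟨L₀, hL₀⟩, rfl⟩)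

theorem sum_uniform_weight {α : Type*} {s : Finset α} (hs : s.Nonempty) :
    ∑ _x ∈ s, ((s.card : ℝ))⁻¹ = 1 := by
  rw [Finset.sum_const, nsmul_eq_mul, mul_inv_cancel₀]
  exact_mod_cast (Finset.card_pos.2 hs).ne'

/-- A nontrivial affine relation, scaled down, could be added to the uniform weights to give a
second positive convex combination for the barycentre. -/
theorem IsLayeringSimplex.affineIndependent [Finite V] [Fintype E] (hG : G.Acyclic)
    (hb : IsUnitSupply G b) (hF : IsFramed G b F) {𝓛 : Finset (Finset G.Route)}
    (h : IsLayeringSimplex G b F 𝓛) :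
    AffineIndependent ℝ (fun L : 𝓛 => routesFlow (L : Finset G.Route)) := by
  rw [affineIndependent_iff]
  intro s w hw0 hw1 L₀ hL₀
  have hne : 𝓛.Nonempty := ⟨L₀.1, L₀.2⟩
  have hcard : (0 : ℝ) < 𝓛.card := by exact_mod_cast Finset.card_pos.2 hne
  let v : Finset G.Route → ℝ :=
    fun L => if hL : L ∈ 𝓛 then (if ⟨L, hL⟩ ∈ s then w ⟨L, hL⟩ else 0) else 0
  have hv : ∀ L : 𝓛, v L.1 = if L ∈ s then w L else 0 := fun L => by simp [v]
  have hinter : 𝓛.attach ∩ s = s := Finset.inter_eq_right.2 fun x _ => Finset.mem_attach _ _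
  have hv0 : ∑ L ∈ 𝓛, v L = 0 := by
    rw [← Finset.sum_attach, Finset.sum_congr rfl fun L _ => hv L]
    simpa [hinter] using hw0
  have hv1 : ∑ L ∈ 𝓛, v L • routesFlow L = 0 := by
    rw [← Finset.sum_attach]
    simp_rw [hv, ite_smul, zero_smul]
    simpa [hinter] using hw1
  let S := ∑ L ∈ 𝓛, |v L|
  have hS : 0 ≤ S := Finset.sum_nonneg fun L _ => abs_nonneg _
  -- Chosen so that `δ * |v L|` is less than the uniform weight for every `L`.
  let δ : ℝ := (𝓛.card : ℝ)⁻¹ * (1 + S)⁻¹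
  have hδ : 0 < δ := by positivity
  have hsmall : ∀ L ∈ 𝓛, 0 < (𝓛.card : ℝ)⁻¹ + δ * v L := by
    intro L hL
    have h1 : |v L| ≤ S := Finset.single_le_sum (fun L _ => abs_nonneg (v L)) hL
    have h2 : δ * (1 + S) = (𝓛.card : ℝ)⁻¹ := by
      simp only [δ]
      field_simp
    have h3 := neg_abs_le (v L)
    rw [← h2]
    nlinarith
  have := (h.convexCombination_unique hG hb hF h (μ := fun L => (𝓛.card : ℝ)⁻¹ + δ * v L)
    (ν := fun _ => (𝓛.card : ℝ)⁻¹) hsmall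
    (by rw [Finset.sum_add_distrib, ← Finset.mul_sum, hv0, sum_uniform_weight hne]; ring)
    (fun _ _ => by positivity) (sum_uniform_weight hne)
    (by
      have hδv : ∑ L ∈ 𝓛, δ • v L • routesFlow L = 0 := by
        rw [← Finset.smul_sum, hv1, smul_zero]
      simp_rw [add_smul, mul_smul]
      rw [Finset.sum_add_distrib, hδv, add_zero])).2 L₀.1 L₀.2
  have hz : δ * v L₀.1 = 0 := by simpa using this
  have := (mul_eq_zero.1 hz).resolve_left hδ.ne'
  rwa [hv, if_pos hL₀] at this

theorem flowPolytope_lineMap_mem [Fintype E] {x y : E → ℝ} (hx : x ∈ G.flowPolytope b)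
    (hy : y ∈ G.flowPolytope b) {ε : ℝ} (h0 : 0 ≤ ε) (h1 : ε ≤ 1) :
    x + ε • (y - x) ∈ G.flowPolytope b := by
  refine ⟨fun e => ?_, fun i => ?_⟩
  · have := hx.1 e
    have := hy.1 e
    simp only [Pi.add_apply, Pi.smul_apply, Pi.sub_apply, smul_eq_mul]
    nlinarith
  · have h2 := hx.2 i
    have h3 := hy.2 i
    simp only [Pi.add_apply, Pi.smul_apply, Pi.sub_apply, smul_eq_mul, Finset.sum_add_distrib,
      ← Finset.mul_sum, Finset.sum_sub_distrib]
    linear_combination (1 - ε) * h2 + ε * h3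

theorem flowHull_subset [Fintype E] (hb : IsUnitSupply G b) {𝓛 : Finset (Finset G.Route)}
    (h : ∀ L ∈ 𝓛, IsLayering G b L) : flowHull 𝓛 ⊆ G.flowPolytope b := by
  intro x hx
  obtain ⟨μ, h0, h1, rfl⟩ := mem_flowHull.1 hx
  refine ⟨fun e => ?_, fun i => ?_⟩
  · simp only [Finset.sum_apply, Pi.smul_apply, smul_eq_mul]
    exact Finset.sum_nonneg fun L hL =>
      mul_nonneg (h0 L hL) (((h L hL).routesFlow_mem hb).1 e)
  · simp only [Finset.sum_apply, Pi.smul_apply, smul_eq_mul]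
    rw [Finset.sum_comm, Finset.sum_comm (t := 𝓛), ← Finset.sum_sub_distrib]
    simp_rw [← Finset.mul_sum, ← mul_sub]
    rw [Finset.sum_congr rfl fun L hL => by rw [((h L hL).routesFlow_mem hb).2 i],
      ← Finset.sum_mul, h1, one_mul]

/-- Near the barycentre `x` of a maximal simplex, the polytope coincides with the hull of that
simplex, because `x` has positive distance from all other hulls. -/
theorem vectorSpan_flowPolytope_eq [Fintype V] [Fintype E] (hG : G.Acyclic)
    (hb : IsUnitSupply G b) (hF : IsFramed G b F) (hb0 : b ≠ 0) {𝓛 : Finset (Finset G.Route)}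
    (h𝓛 : Maximal (IsLayeringSimplex G b F) 𝓛) (hne : 𝓛.Nonempty) :
    vectorSpan ℝ (G.flowPolytope b) =
      vectorSpan ℝ (Set.range fun L : 𝓛 => routesFlow (L : Finset G.Route)) := by
  have := DirGraph.Route.finite hG
  have hcard : (0 : ℝ) < 𝓛.card := by exact_mod_cast Finset.card_pos.2 hne
  let x : E → ℝ := ∑ L ∈ 𝓛, ((𝓛.card : ℝ))⁻¹ • routesFlow L
  have hxP : x ∈ G.flowPolytope b := flowHull_subset hb h𝓛.prop.layering
    (mem_flowHull.2 ⟨fun _ => (𝓛.card : ℝ)⁻¹, fun _ _ => by positivity, sum_uniform_weight hne, rfl⟩)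
  -- By uniqueness, the members of `𝓜` with positive coefficient form `𝓛`; so `𝓛 ⊆ 𝓜`, and
  -- maximality gives equality.
  have huniq : ∀ 𝓜, IsLayeringSimplex G b F 𝓜 → x ∈ flowHull 𝓜 → 𝓜 = 𝓛 := by
    intro 𝓜 h𝓜 hx
    obtain ⟨μ, h0, h1, hxμ⟩ := mem_flowHull.1 hx
    have hsub : 𝓜.filter (fun L => 0 < μ L) ⊆ 𝓜 := Finset.filter_subset _ _
    have hzero : ∀ L ∈ 𝓜, L ∉ 𝓜.filter (fun L => 0 < μ L) → μ L = 0 := by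
      intro L hL hn
      exact le_antisymm (not_lt.1 fun hpos => hn (Finset.mem_filter.2 ⟨hL, hpos⟩)) (h0 L hL)
    have := ((h𝓜.subset hsub).convexCombination_unique hG hb hF h𝓛.prop (μ := μ)
      (ν := fun _ => (𝓛.card : ℝ)⁻¹) (fun L hL => (Finset.mem_filter.1 hL).2)
      (by rw [Finset.sum_subset hsub hzero, h1]) (fun _ _ => by positivity)
      (sum_uniform_weight hne) (by
        rw [Finset.sum_subset hsub fun L hL hn => by rw [hzero L hL hn, zero_smul], hxμ])).1
    exact h𝓛.eq_of_ge h𝓜 (this ▸ hsub)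
  let C : Set (E → ℝ) := ⋃ 𝓜 ∈ {𝓜 | IsLayeringSimplex G b F 𝓜 ∧ 𝓜 ≠ 𝓛}, flowHull 𝓜
  have hC : IsClosed C := (Set.toFinite _).isClosed_biUnion fun 𝓜 _ => isClosed_flowHull 𝓜
  have hxC : x ∉ C := by
    intro hx
    simp only [C, Set.mem_iUnion, Set.mem_ofPred_eq, exists_prop] at hx
    obtain ⟨𝓜, ⟨h𝓜, hneq⟩, hx⟩ := hx
    exact hneq (huniq 𝓜 h𝓜 hx)
  apply le_antisymm
  · rw [vectorSpan_eq_span_vsub_set_right ℝ hxP, Submodule.span_le]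
    rintro _ ⟨y, hy, rfl⟩
    -- Only small positive `ε` matter: the point then lies in the polytope but in no hull other than
    -- that of `𝓛`.
    have hev : ∀ᶠ ε in nhdsWithin (0 : ℝ) (Set.Ioi 0), x + ε • (y - x) ∉ C := by
      have hcont : Continuous fun ε : ℝ => x + ε • (y - x) := by fun_prop
      have h1 : Filter.Tendsto (fun ε : ℝ => x + ε • (y - x)) (nhdsWithin 0 (Set.Ioi 0))
          (nhds x) := by
        have := hcont.tendsto 0
        rw [zero_smul, add_zero] at this
        exact this.mono_left nhdsWithin_le_nhds
      exact h1.eventually (hC.isOpen_compl.mem_nhds hxC)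
    obtain ⟨ε, hε, hε0, hε1⟩ := (hev.and (Ioo_mem_nhdsGT (zero_lt_one' ℝ))).exists
    obtain ⟨𝓜, μ, h𝓜, hμ, hμ1, hμx⟩ := exists_convexCombination hG hb hF hb0
      (flowPolytope_lineMap_mem hxP hy hε0.le hε1.le)
    have h𝓜𝓛 : 𝓜 = 𝓛 := by
      by_contra hneq
      apply hε
      simp only [C, Set.mem_iUnion, Set.mem_ofPred_eq, exists_prop]
      exact ⟨𝓜, ⟨h𝓜, hneq⟩, mem_flowHull.2 ⟨μ, fun L hL => (hμ L hL).le, hμ1, hμx⟩⟩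
    subst h𝓜𝓛
    have hdiff : ε • (y - x) = ∑ L ∈ 𝓜, (μ L - (𝓜.card : ℝ)⁻¹) • routesFlow L := by
      simp_rw [sub_smul]
      rw [Finset.sum_sub_distrib, hμx]
      simp [x]
    have hmem : ε • (y - x) ∈
        vectorSpan ℝ (Set.range fun L : 𝓜 => routesFlow (L : Finset G.Route)) := by
      rw [hdiff]
      apply sum_smul_routesFlow_mem_vectorSpan
      rw [Finset.sum_sub_distrib, hμ1, sum_uniform_weight hne, sub_self]
    exact (Submodule.smul_mem_iff _ hε0.ne').1 hmem
  · apply vectorSpan_mono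
    rintro _ ⟨L, rfl⟩
    exact (h𝓛.prop.layering L.1 L.2).routesFlow_mem hb

/-- Inclusion-maximal layering-simplices have one more element than the dimension of the flow
polytope. -/
theorem card_of_maximal_isLayeringSimplex [Fintype V] [Fintype E] (hG : G.Acyclic)
    (hb : IsUnitSupply G b) (hF : IsFramed G b F) (hb0 : b ≠ 0) {𝓛 : Finset (Finset G.Route)}
    (h𝓛 : Maximal (IsLayeringSimplex G b F) 𝓛) :
    (𝓛.card : ℤ) = polytopeDim (G.flowPolytope b) + 1 := by
  rcases 𝓛.eq_empty_or_nonempty with rfl | hne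
  -- A point of the polytope would give a nonempty simplex, since its coefficients sum to 1, and `∅`
  -- would not be maximal.
  · have : G.flowPolytope b = ∅ := by
      rw [Set.eq_empty_iff_forall_notMem]
      intro f hf
      obtain ⟨𝓜, μ, h𝓜, -, hμ1, -⟩ := exists_convexCombination hG hb hF hb0 hf
      obtain rfl := h𝓛.eq_of_ge h𝓜 (Finset.empty_subset _)
      simp at hμ1
    rw [polytopeDim, if_pos this]
    simp
  · obtain ⟨L, hL⟩ := id hne
    have hP : G.flowPolytope b ≠ ∅ :=
      Set.Nonempty.ne_empty ⟨_, (h𝓛.prop.layering L hL).routesFlow_mem hb⟩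
    have hcard : Fintype.card 𝓛 = (𝓛.card - 1) + 1 := by
      have := Finset.card_pos.2 hne
      rw [Fintype.card_coe]
      omega
    rw [polytopeDim, if_neg hP, vectorSpan_flowPolytope_eq hG hb hF hb0 h𝓛 hne,
      (h𝓛.prop.affineIndependent hG hb hF).finrank_vectorSpan hcard]
    rw [Fintype.card_coe] at hcard
    omega

end Purity

/-! ### Conservationist graphs and augmentations as special cases. -/

section Augmented

variable {V E : Type*} {G : DirGraph V E} {a : V → ℤ}

theorem DirGraph.IsConservationist.isUnitSupply (h : G.IsConservationist a) :
    IsUnitSupply G a where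
  source := fun i hi => Or.inr (h.source i hi)
  sink := fun i hi => (h.sink i hi).le
  internal := h.internal

theorem IsConsFraming.isFramed {F : FramingData V E} (h : IsConsFraming G F) :
    IsFramed G a F where
  out := by
    intro i
    by_cases hi : G.IsSink i
    · exact TotalOrderOn.of_subsingleton fun e he => absurd he (hi e)
    · exact (h.out i hi).ne_and
  inc := by
    intro i hi
    by_cases hs : G.IsSource i
    · exact TotalOrderOn.of_subsingleton fun e he => absurd he (hs e)
    · exact (h.inc i ⟨hs, hi⟩).ne_and
  src := h.src.mono fun _ hs => hs.1

variable {X Y EX EY : Type*} [Fintype EX] [Fintype EY]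

/-- The net outflow of a function on the edges at a vertex. -/
noncomputable def DirGraph.netOutflow {V E : Type*} [Fintype E] (G : DirGraph V E) (f : E → ℝ)
    (i : V) : ℝ := ∑ e with G.tail e = i, f e - ∑ e with G.head e = i, f e

theorem DirGraph.mem_flowPolytope {V E : Type*} [Fintype E] {G : DirGraph V E} {a : V → ℤ}
    {f : E → ℝ} : f ∈ G.flowPolytope a ↔ (∀ e, 0 ≤ f e) ∧ ∀ i, G.netOutflow f i = a i :=
  Iff.rfl

namespace Augmentation

/-- An inflow edge starts at no old vertex, and an outflow edge ends where no edge leaves. So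
augmenting creates no cycles. -/
theorem inl_path (A : Augmentation G a X Y EX EY) {i j : V} {p : List (E ⊕ EX ⊕ EY)}
    (h : A.graph.IsPath (.inl i) p (.inl j)) :
    ∃ q : List E, p = q.map Sum.inl ∧ G.IsPath i q j := by
  induction p generalizing i with
  | nil => exact ⟨[], rfl, Sum.inl_injective h⟩
  | cons e p ih =>
    obtain ⟨he, h⟩ := h
    rcases e with e | x | y
    · obtain ⟨q, rfl, hq⟩ := ih h
      exact ⟨e :: q, rfl, Sum.inl_injective he, hq⟩
    · cases he
    · cases p with
      | nil => cases h
      | cons e p =>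
        have he' := h.1
        rcases e with e | x | y <;> cases he'

theorem not_head_inflow (A : Augmentation G a X Y EX EY) (x : X) (e : E ⊕ EX ⊕ EY) :
    A.graph.head e ≠ .inr (.inl x) := by
  rcases e with e | x' | y <;> simp [graph]

theorem not_tail_outflow (A : Augmentation G a X Y EX EY) (y : Y) (e : E ⊕ EX ⊕ EY) :
    A.graph.tail e ≠ .inr (.inr y) := by
  rcases e with e | x' | y <;> simp [graph]

theorem acyclic_graph (A : Augmentation G a X Y EX EY) (hG : G.Acyclic) : A.graph.Acyclic := by
  intro v p h
  rcases v with i | x | y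
  · obtain ⟨q, rfl, hq⟩ := A.inl_path h
    rw [hG i q hq, List.map_nil]
  · exact h.eq_nil_of_isSource (A.not_head_inflow x)
  · exact h.eq_nil_of_isSink (A.not_tail_outflow y)

/-- Old vertices may be sources or sinks of the augmented graph, with netflow 0; this is why zero
supply is allowed. -/
theorem isUnitSupply (A : Augmentation G a X Y EX EY) : IsUnitSupply A.graph A.netflow where
  source := by
    rintro (i | x | y) hi
    · exact Or.inl rfl
    · exact Or.inr rfl
    · obtain ⟨e, rfl⟩ := A.yHead_bijective.2 y
      exact absurd rfl (hi (.inr (.inr e)))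
  sink := by
    rintro (i | x | y) hi
    · exact le_rfl
    · obtain ⟨e, rfl⟩ := A.xTail_bijective.2 x
      exact absurd rfl (hi (.inr (.inl e)))
    · exact (A.yNetflow_neg y).le
  internal := by
    rintro (i | x | y) hi
    · rfl
    · exact absurd (A.not_head_inflow x) hi.1
    · exact absurd (A.not_tail_outflow y) hi.2

theorem IsFraming.isFramed {A : Augmentation G a X Y EX EY}
    {F : FramingData (V ⊕ X ⊕ Y) (E ⊕ EX ⊕ EY)} (h : A.IsFraming F) :
    IsFramed A.graph A.netflow F where
  out := by
    rintro (i | x | y)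
    · exact (h.out i).ne_and
    · refine TotalOrderOn.of_subsingleton fun e he f hf => ?_
      rcases e with e | e | e
      · cases he
      · rcases f with f | f | f
        · cases hf
        · have h1 : A.xTail e = x := Sum.inl_injective (Sum.inr_injective he)
          have h2 : A.xTail f = x := Sum.inl_injective (Sum.inr_injective hf)
          rw [A.xTail_bijective.1 (h1.trans h2.symm)]
        · cases hf
      · cases he
    · exact TotalOrderOn.of_subsingleton fun e he => absurd he (A.not_tail_outflow y e)
  inc := by
    rintro (i | x | y) hi
    · exact (h.inc i).ne_and
    · exact TotalOrderOn.of_subsingleton fun e he => absurd he (A.not_head_inflow x e)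
    · exact absurd (A.not_tail_outflow y) hi
  src := by
    refine h.src.mono ?_
    rintro (i | x | y) hi
    · exact absurd hi.2 (zero_ne_one' ℤ)
    · exact ⟨x, rfl⟩
    · have h1 : A.yNetflow y = 1 := hi.2
      have := A.yNetflow_neg y
      omega

theorem netflow_ne_zero (A : Augmentation G a X Y EX EY) (ha : a ≠ 0) : A.netflow ≠ 0 := by
  intro h0
  apply ha
  funext i
  rcases lt_trichotomy (a i) 0 with h | h | h
  · have := A.one_le_card_outflow i h
    obtain ⟨y, -⟩ : Nonempty {y : EY // A.yTail y = i} := by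
      by_contra hemp
      rw [not_nonempty_iff] at hemp
      rw [Nat.card_of_isEmpty] at this
      simp at this
    have h1 : A.yNetflow (A.yHead y) = 0 := congrFun h0 (.inr (.inr (A.yHead y)))
    exact absurd h1 (A.yNetflow_neg _).ne
  · exact h
  · have := A.card_inflow i h
    obtain ⟨x, -⟩ : Nonempty {x : EX // A.xHead x = i} := by
      by_contra hemp
      rw [not_nonempty_iff] at hemp
      rw [Nat.card_of_isEmpty] at this
      simp at this
      omega
    have h1 : (1 : ℤ) = 0 := congrFun h0 (.inr (.inl (A.xTail x)))
    exact absurd h1 one_ne_zero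

@[simp] theorem graph_tail_inl (A : Augmentation G a X Y EX EY) (e : E) :
    A.graph.tail (.inl e) = .inl (G.tail e) := rfl

@[simp] theorem graph_tail_inflow (A : Augmentation G a X Y EX EY) (x : EX) :
    A.graph.tail (.inr (.inl x)) = .inr (.inl (A.xTail x)) := rfl

@[simp] theorem graph_tail_outflow (A : Augmentation G a X Y EX EY) (y : EY) :
    A.graph.tail (.inr (.inr y)) = .inl (A.yTail y) := rfl

@[simp] theorem graph_head_inl (A : Augmentation G a X Y EX EY) (e : E) :
    A.graph.head (.inl e) = .inl (G.head e) := rfl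

@[simp] theorem graph_head_inflow (A : Augmentation G a X Y EX EY) (x : EX) :
    A.graph.head (.inr (.inl x)) = .inl (A.xHead x) := rfl

@[simp] theorem graph_head_outflow (A : Augmentation G a X Y EX EY) (y : EY) :
    A.graph.head (.inr (.inr y)) = .inr (.inr (A.yHead y)) := rfl

/-- The extension of functions on the old edges to the augmented graph with value zero on the
new edges. -/
def extend (E EX EY : Type*) : (E → ℝ) →ₗ[ℝ] (E ⊕ EX ⊕ EY → ℝ) where
  toFun f := Sum.elim f 0
  map_add' f g := by
    funext e
    rcases e with e | e <;> simp
  map_smul' c f := by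
    funext e
    rcases e with e | e <;> simp

/-- The forced flow on the new edges. -/
def newFlow (A : Augmentation G a X Y EX EY) : E ⊕ EX ⊕ EY → ℝ
  | .inl _ => 0
  | .inr (.inl _) => 1
  | .inr (.inr y) => -A.yNetflow (A.yHead y)

/-- At an old vertex the new edges contribute `-a i` to the net outflow: `a i` units come in if `a i
> 0`, and `|a i|` units leave if `a i < 0`. -/
theorem netOutflow_inl [Fintype E] (A : Augmentation G a X Y EX EY)
    {f : E ⊕ EX ⊕ EY → ℝ} (hx : ∀ x, f (.inr (.inl x)) = 1)
    (hy : ∀ y, f (.inr (.inr y)) = -A.yNetflow (A.yHead y)) (i : V) :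
    A.graph.netOutflow f (.inl i) = G.netOutflow (fun e => f (.inl e)) i - a i := by
  have h1 : A.graph.netOutflow f (.inl i) = G.netOutflow (fun e => f (.inl e)) i +
      ∑ y with A.yTail y = i, -(A.yNetflow (A.yHead y) : ℝ) -
        (Nat.card {x : EX // A.xHead x = i} : ℝ) := by
    rw [Nat.card_eq_fintype_card, Fintype.card_subtype]
    simp only [DirGraph.netOutflow, Finset.sum_filter, Fintype.sum_sum_type, graph_tail_inl,
      graph_tail_inflow, graph_tail_outflow, graph_head_inl, graph_head_inflow,
      graph_head_outflow, hx, hy, Sum.inl.injEq, reduceCtorEq, if_false, Finset.sum_const_zero,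
      Finset.sum_boole]
    ring
  rw [h1]
  have hyne : ∀ y, A.yTail y = i → a i < 0 := fun y hy => hy ▸ A.yTail_neg y
  have hxne : ∀ x, A.xHead x = i → 0 < a i := fun x hx => hx ▸ A.xHead_pos x
  have hy0 : ¬ a i < 0 → ∑ y with A.yTail y = i, -(A.yNetflow (A.yHead y) : ℝ) = 0 := by
    intro h
    exact Finset.sum_eq_zero fun y hy => absurd (hyne y (by simpa using hy)) h
  have hx0 : ¬ 0 < a i → (Nat.card {x : EX // A.xHead x = i} : ℝ) = 0 := by
    intro h
    have : IsEmpty {x : EX // A.xHead x = i} := ⟨fun x => h (hxne x.1 x.2)⟩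
    rw [Nat.card_of_isEmpty, Nat.cast_zero]
  rcases lt_trichotomy (a i) 0 with h | h | h
  · have h3 : (a i : ℝ) = ∑ y with A.yTail y = i, (A.yNetflow (A.yHead y) : ℝ) := by
      exact_mod_cast congrArg (Int.cast : ℤ → ℝ) (A.sum_yNetflow i h)
    rw [hx0 (by omega), Finset.sum_neg_distrib, ← h3]
    ring
  · rw [hx0 (by omega), hy0 (by omega), h]
    simp
  · have h3 : (Nat.card {x : EX // A.xHead x = i} : ℝ) = a i := by
      exact_mod_cast A.card_inflow i h
    rw [hy0 (by omega), h3]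
    ring

theorem netOutflow_inflow [Fintype E] (A : Augmentation G a X Y EX EY) (f : E ⊕ EX ⊕ EY → ℝ)
    (x : EX) : A.graph.netOutflow f (.inr (.inl (A.xTail x))) = f (.inr (.inl x)) := by
  simp [DirGraph.netOutflow, Finset.sum_filter, A.xTail_bijective.1.eq_iff]

theorem netOutflow_outflow [Fintype E] (A : Augmentation G a X Y EX EY) (f : E ⊕ EX ⊕ EY → ℝ)
    (y : EY) : A.graph.netOutflow f (.inr (.inr (A.yHead y))) = -f (.inr (.inr y)) := by
  simp [DirGraph.netOutflow, Finset.sum_filter, A.yHead_bijective.1.eq_iff]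

/-- The flow polytope of an augmentation is a translate of the embedded original polytope. -/
theorem flowPolytope_graph [Fintype E] (A : Augmentation G a X Y EX EY) :
    A.graph.flowPolytope A.netflow =
      (fun f => A.newFlow + f) '' (extend E EX EY '' G.flowPolytope a) := by
  ext f
  simp only [Set.mem_image, exists_exists_and_eq_and]
  constructor
  · intro hf
    obtain ⟨h0, hn⟩ := DirGraph.mem_flowPolytope.1 hf
    have hx : ∀ x, f (.inr (.inl x)) = 1 := by
      intro x
      rw [← A.netOutflow_inflow f x, hn]
      simp [netflow]
    have hy : ∀ y, f (.inr (.inr y)) = -A.yNetflow (A.yHead y) := by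
      intro y
      rw [← neg_eq_iff_eq_neg, ← A.netOutflow_outflow f y, hn]
      rfl
    refine ⟨fun e => f (.inl e), DirGraph.mem_flowPolytope.2 ⟨fun e => h0 _, fun i => ?_⟩, ?_⟩
    · have := hn (.inl i)
      rw [A.netOutflow_inl hx hy] at this
      simp only [netflow, Int.cast_zero] at this
      linarith
    · funext e
      rcases e with e | x | y
      · simp [extend, newFlow]
      · simp [extend, newFlow, hx]
      · simp [extend, newFlow, hy]
  · rintro ⟨g, hg, rfl⟩
    obtain ⟨h0, hn⟩ := DirGraph.mem_flowPolytope.1 hg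
    refine DirGraph.mem_flowPolytope.2 ⟨?_, ?_⟩
    · rintro (e | x | y)
      · simpa [extend, newFlow] using h0 e
      · simp [extend, newFlow]
      · have : (A.yNetflow (A.yHead y) : ℝ) ≤ 0 := by exact_mod_cast (A.yNetflow_neg _).le
        simpa [extend, newFlow] using this
    · rintro (i | x | y)
      · rw [A.netOutflow_inl (by simp [extend, newFlow]) (by simp [extend, newFlow])]
        have hg : (fun e => (A.newFlow + extend E EX EY g) (.inl e)) = g := by
          funext e
          simp [extend, newFlow]
        rw [hg, hn]
        simp [netflow]
      · obtain ⟨x, rfl⟩ := A.xTail_bijective.2 x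
        rw [A.netOutflow_inflow]
        simp [extend, newFlow, netflow]
      · obtain ⟨y, rfl⟩ := A.yHead_bijective.2 y
        rw [A.netOutflow_outflow]
        simp [extend, newFlow, netflow]

open scoped Pointwise in
-- Translation and an injective linear map preserve the dimension of the affine span and emptiness.
theorem polytopeDim_graph [Fintype E] (A : Augmentation G a X Y EX EY) :
    polytopeDim (A.graph.flowPolytope A.netflow) = polytopeDim (G.flowPolytope a) := by
  have hinj : Function.Injective (extend E EX EY) := by
    intro f g h
    funext e
    exact congrFun h (.inl e)
  have hspan : vectorSpan ℝ (A.graph.flowPolytope A.netflow) =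
      (vectorSpan ℝ (G.flowPolytope a)).map (extend E EX EY) := by
    have h1 : (fun f => A.newFlow + f) '' (extend E EX EY '' G.flowPolytope a) =
        A.newFlow +ᵥ (extend E EX EY '' G.flowPolytope a) := rfl
    rw [A.flowPolytope_graph, h1, vectorSpan_vadd]
    exact ((extend E EX EY).toAffineMap.map_vectorSpan).symm
  rw [polytopeDim, polytopeDim, hspan,
    ← (Submodule.equivMapOfInjective (extend E EX EY) hinj _).finrank_eq]
  have : A.graph.flowPolytope A.netflow = ∅ ↔ G.flowPolytope a = ∅ := by
    rw [A.flowPolytope_graph, Set.image_eq_empty, Set.image_eq_empty]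
  simp only [this]

end Augmentation

end Augmented
end FramedFlow

theorem corollary4p7 {V E : Type*} [Fintype V] [Fintype E]
    (G : FramedFlow.DirGraph V E) (hG : G.Acyclic) (a : V → ℤ) (ha : a ≠ 0) :
    (∀ {X Y EX EY : Type*} [Fintype X] [Fintype Y] [Fintype EX] [Fintype EY]
        (A : FramedFlow.Augmentation G a X Y EX EY)
        (F : FramedFlow.FramingData (V ⊕ X ⊕ Y) (E ⊕ EX ⊕ EY)), A.IsFraming F →
        ∀ 𝓛 : Finset (Finset A.graph.Route),
          Maximal (FramedFlow.IsLayeringSimplex A.graph A.netflow F) 𝓛 →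
          (𝓛.card : ℤ) = FramedFlow.polytopeDim (G.flowPolytope a) + 1) ∧
    (∀ F : FramedFlow.FramingData V E, G.IsConservationist a → FramedFlow.IsConsFraming G F →
        ∀ 𝓛 : Finset (Finset G.Route),
          Maximal (FramedFlow.IsLayeringSimplex G a F) 𝓛 →
          (𝓛.card : ℤ) = FramedFlow.polytopeDim (G.flowPolytope a) + 1) := by
  refine ⟨?_, ?_⟩
  · intro X Y EX EY _ _ _ _ A F hF 𝓛 h𝓛
    rw [← A.polytopeDim_graph]
    exact FramedFlow.card_of_maximal_isLayeringSimplex (A.acyclic_graph hG) A.isUnitSupply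
      hF.isFramed (A.netflow_ne_zero ha) h𝓛
  · intro F hcons hF 𝓛 h𝓛
    exact FramedFlow.card_of_maximal_isLayeringSimplex hG hcons.isUnitSupply hF.isFramed ha h𝓛
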